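/- Let $1<\alpha<2$. Put $g_k=(-1)^k\binom{\alpha}{k}$ and $q_k=\left(\frac32\right)^{\alpha}\sum_{m=0}^{k}3^{-m}g_m g_{k-m}$ for $k\ge 0$, and $q_k=0$ for $k<0$ (so that $\sum_{k\ge0}q_k\zeta^k=(\frac32-2\zeta+\frac12\zeta^2)^\alpha$). For $n\in\mathbb N$ and integers $p,q,r,s,\bar p,\bar q,\bar r,\bar s$ define the real $n\times n$ matrices $$A_p=(q_{p+i-j})_{i,j=1}^{n},\qquad A_{p,q}=\frac{q}{q-p}A_p+\frac{p}{p-q}A_q,$$ $$A_{p,q,r,s}=\frac{3rs+2\alpha}{3(rs-pq)}A_{p,q}+\frac{3pq+2\alpha}{3(pq-rs)}A_{r,s},$$ and, with $a=rs-pq$ and $b=6pqrs(r+s-p-q)+4\alpha[rs(r+s)-pq(p+q)]+9\alpha(rs-pq)$, and $\bar a,\bar b$ given by the same formulas in $\bar p,\bar q,\bar r,\bar s$, the fourth-order WSLD (weighted and shifted Lubich difference) matrix $$A_\alpha=\frac{a\bar b}{a\bar b-\bar a b}A_{p,q,r,s}+\frac{\bar a b}{\bar a b-a\bar b}A_{\bar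 p,\bar q,\bar r,\bar s}.$$ Assume that $a\bar b\neq\bar a b$ and that $(p,q,r,s,\bar p,\bar q,\bar r,\bar s)$ is either $(1,2,1,-2,1,\bar q,1,\bar s)$ with $|\bar q|\ge2$, $|\bar s|\ge2$, $(\bar q,\bar s)\ne(2,-2)$ and $\bar q\,\bar s<0$, or one of $(1,2,1,0,1,2,1,-2)$, $(1,2,1,0,1,-1,1,-2)$, $(1,2,1,-1,1,2,1,-2)$, $(1,2,1,-1,1,-1,1,-2)$, $(1,0,1,-1,1,2,1,-2)$, $(1,0,1,-2,1,2,1,-2)$, $(1,-1,1,-2,1,2,1,-2)$. Theorem 4.1. Let $D_+$ be a real $n\times n$ diagonal matrix with nonnegative diagonal entries and let $\kappa_\alpha\ge0$. Then every nonzero (complex) eigenvalue $\lambda$ of $D_+(A_\alpha+\kappa_\alpha A_\alpha^T)$ satisfies $\Re\lambda<0$. If all diagonal entries of $D_+$ are positive, then every eigenvalue $\lambda$ of $D_+(A_\alpha+\kappa_\alpha A_\alpha^T)$ satisfies $\Re\lambda<0$. -/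

import Mathlib

namespace WSLD

/-- `g_k^α = (-1)^k binom(α, k)`, the power series coefficients of `(1 - ζ)^α`. -/
noncomputable def g (α : ℝ) (k : ℕ) : ℝ := (-1) ^ k * Ring.choose α k

/-- The second order Lubich coefficients `q_k^α`, i.e. the power series coefficients of
`(3/2 - 2 ζ + ζ² / 2)^α`, extended by `q_k^α = 0` for `k < 0`. -/
noncomputable def q (α : ℝ) (k : ℤ) : ℝ :=
  if k < 0 then 0
  else (3 / 2 : ℝ) ^ α *
    ∑ m ∈ Finset.range (k.toNat + 1), ((3 : ℝ) ^ m)⁻¹ * g α m * g α (k.toNat - m)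

/-- The `n × n` Toeplitz matrix `A_p^α` of the Lubich operator shifted by `p`: its diagonal entries
are `q_p^α`, the entries directly below them `q_{p+1}^α`, those directly above `q_{p-1}^α`. -/
noncomputable def A₁ (α : ℝ) (n : ℕ) (p : ℤ) : Matrix (Fin n) (Fin n) ℝ :=
  Matrix.of fun i j => q α (p + (i : ℤ) - (j : ℤ))

/-- The second order WSLD matrix `A_{p,q}^α = w_p A_p^α + w_q A_q^α` with
`w_p = q / (q - p)` and `w_q = p / (p - q)` (for `p ≠ q`). -/
noncomputable def A₂ (α : ℝ) (n : ℕ) (p q : ℤ) : Matrix (Fin n) (Fin n) ℝ :=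
  ((q : ℝ) / ((q : ℝ) - p)) • A₁ α n p + ((p : ℝ) / ((p : ℝ) - q)) • A₁ α n q

/-- The third order WSLD matrix `A_{p,q,r,s}^α = w_{p,q} A_{p,q}^α + w_{r,s} A_{r,s}^α` with
`w_{p,q} = (3 r s + 2 α) / (3 (r s - p q))` and `w_{r,s} = (3 p q + 2 α) / (3 (p q - r s))`
(for `r s ≠ p q`). -/
noncomputable def A₃ (α : ℝ) (n : ℕ) (p q r s : ℤ) : Matrix (Fin n) (Fin n) ℝ :=
  ((3 * (r : ℝ) * s + 2 * α) / (3 * ((r : ℝ) * s - p * q))) • A₂ α n p q +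
    ((3 * (p : ℝ) * q + 2 * α) / (3 * ((p : ℝ) * q - r * s))) • A₂ α n r s

/-- `a_{p,q,r,s} = r s - p q`. -/
def a (p q r s : ℤ) : ℝ := (r : ℝ) * s - p * q

/-- `b_{p,q,r,s} = 6 p q r s (r + s - p - q) + 4 α (r s (r + s) - p q (p + q)) + 9 α (r s - p q)`. -/
def b (α : ℝ) (p q r s : ℤ) : ℝ :=
  6 * (p : ℝ) * q * r * s * ((r : ℝ) + s - p - q) +
    4 * α * ((r : ℝ) * s * ((r : ℝ) + s) - (p : ℝ) * q * ((p : ℝ) + q)) +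
    9 * α * ((r : ℝ) * s - p * q)

/-- The fourth order WSLD matrix
`A_{p,q,r,s,p',q',r',s'}^α = w_{p,q,r,s} A_{p,q,r,s}^α + w_{p',q',r',s'} A_{p',q',r',s'}^α` with
`w_{p,q,r,s} = a b' / (a b' - a' b)` and `w_{p',q',r',s'} = a' b / (a' b - a b')`
(for `a b' ≠ a' b`). -/
noncomputable def A₄ (α : ℝ) (n : ℕ) (p q r s p' q' r' s' : ℤ) : Matrix (Fin n) (Fin n) ℝ :=
  (a p q r s * b α p' q' r' s' /
      (a p q r s * b α p' q' r' s' - a p' q' r' s' * b α p q r s)) • A₃ α n p q r s +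
    (a p' q' r' s' * b α p q r s /
      (a p' q' r' s' * b α p q r s - a p q r s * b α p' q' r' s')) • A₃ α n p' q' r' s'

/-- The shifts for which the fourth order WSLD scheme is used: the two-parameter family
`(1, 2, 1, -2, 1, q', 1, s')` with `|q'|, |s'| ≥ 2`, `(q', s') ≠ (2, -2)`, `q' s' < 0`, and
seven further octuples. -/
def EffectiveShifts (p q r s p' q' r' s' : ℤ) : Prop :=
  ((p, q, r, s, p', r') = (1, 2, 1, -2, 1, 1) ∧
      2 ≤ |q'| ∧ 2 ≤ |s'| ∧ (q', s') ≠ (2, -2) ∧ q' * s' < 0) ∨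
    (p, q, r, s, p', q', r', s') = (1, 2, 1, 0, 1, 2, 1, -2) ∨
    (p, q, r, s, p', q', r', s') = (1, 2, 1, 0, 1, -1, 1, -2) ∨
    (p, q, r, s, p', q', r', s') = (1, 2, 1, -1, 1, 2, 1, -2) ∨
    (p, q, r, s, p', q', r', s') = (1, 2, 1, -1, 1, -1, 1, -2) ∨
    (p, q, r, s, p', q', r', s') = (1, 0, 1, -1, 1, 2, 1, -2) ∨
    (p, q, r, s, p', q', r', s') = (1, 0, 1, -2, 1, 2, 1, -2) ∨
    (p, q, r, s, p', q', r', s') = (1, -1, 1, -2, 1, 2, 1, -2)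

/-- `z` is a complex eigenvalue of the real square matrix `M`. -/
def IsEigenvalue {n : ℕ} (M : Matrix (Fin n) (Fin n) ℝ) (z : ℂ) : Prop :=
  Module.End.HasEigenvalue (Matrix.toLin' (M.map (fun x : ℝ => (x : ℂ)))) z

end WSLD

namespace WSLD

/-! ### Weighted combinations of shifts as linear functionals -/

/-- The second order combination of the values of `h` at two shifts. -/
noncomputable def comb₂ (h : ℤ → ℝ) (p q : ℤ) : ℝ :=
  ((q : ℝ) / ((q : ℝ) - p)) * h p + ((p : ℝ) / ((p : ℝ) - q)) * h q

/-- The third order combination of the values of `h` at the given shifts. -/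
noncomputable def comb₃ (α : ℝ) (h : ℤ → ℝ) (p q r s : ℤ) : ℝ :=
  ((3 * (r : ℝ) * s + 2 * α) / (3 * ((r : ℝ) * s - p * q))) * comb₂ h p q +
    ((3 * (p : ℝ) * q + 2 * α) / (3 * ((p : ℝ) * q - r * s))) * comb₂ h r s

/-- The fourth order combination of the values of `h` at the given shifts. -/
noncomputable def comb₄ (α : ℝ) (h : ℤ → ℝ) (p q r s p' q' r' s' : ℤ) : ℝ :=
  (a p q r s * b α p' q' r' s' /
      (a p q r s * b α p' q' r' s' - a p' q' r' s' * b α p q r s)) * comb₃ α h p q r s +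
    (a p' q' r' s' * b α p q r s /
      (a p' q' r' s' * b α p q r s - a p q r s * b α p' q' r' s')) * comb₃ α h p' q' r' s'

/-- The third divided difference of `h` at the nodes `1, 2, -2, t`. -/
noncomputable def divDiff (h : ℤ → ℝ) (t : ℤ) : ℝ :=
  -h 1 / (3 * (1 - (t : ℝ))) + h 2 / (4 * (2 - (t : ℝ))) - h (-2) / (12 * ((t : ℝ) + 2)) +
    h t / (((t : ℝ) - 1) * (t - 2) * (t + 2))

/-- The third order combination at the shifts `1, 2, -2`. -/
noncomputable def base (α : ℝ) (h : ℤ → ℝ) : ℝ :=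
  (12 - 2 * α) / 9 * h 1 + (α - 3) / 6 * h 2 + (α + 3) / 18 * h (-2)

/-- The fourth order combination at the four shifts `1, 2, -2, t`. -/
noncomputable def fourPoint (α : ℝ) (h : ℤ → ℝ) (t : ℤ) : ℝ :=
  base α h + (24 - 13 * α) / 6 * divDiff h t

/-- The centred fourth difference of `h` at `0`. -/
def fourthDiff (h : ℤ → ℝ) : ℝ := h (-2) - 4 * h (-1) + 6 * h 0 - 4 * h 1 + h 2

theorem fourPoint_eq_mix (α : ℝ) (h : ℤ → ℝ) (t : ℤ) :
    fourPoint α h t = (2 - α) * fourPoint 1 h t + (α - 1) * fourPoint 2 h t := by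
  unfold fourPoint base; ring

/-- The quantity `b / a` for the shifts `1, q, 1, s`. -/
def beta (α : ℝ) (q s : ℤ) : ℝ := 6 * q * s + 4 * α * (q + s) + 13 * α

theorem b_eq_mul_beta (α : ℝ) (q s : ℤ) : b α 1 q 1 s = ((s : ℝ) - q) * beta α q s := by
  unfold b beta; push_cast; ring

theorem beta_ne_of_weights {α : ℝ} {q s q' s' : ℤ}
    (h : a 1 q 1 s * b α 1 q' 1 s' ≠ a 1 q' 1 s' * b α 1 q 1 s) :
    beta α q' s' - beta α q s ≠ 0 := by
  intro hb
  apply h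
  rw [b_eq_mul_beta, b_eq_mul_beta, sub_eq_zero.1 hb]
  unfold a; push_cast; ring

theorem comb₄_eq_beta {α : ℝ} {h : ℤ → ℝ} {q s q' s' : ℤ} (hqs : q ≠ s) (hqs' : q' ≠ s')
    (hβ : beta α q' s' - beta α q s ≠ 0) :
    comb₄ α h 1 q 1 s 1 q' 1 s' =
      (beta α q' s' * comb₃ α h 1 q 1 s - beta α q s * comb₃ α h 1 q' 1 s') /
        (beta α q' s' - beta α q s) := by
  have h1 : (s : ℝ) - q ≠ 0 := sub_ne_zero.2 (by exact_mod_cast hqs.symm)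
  have h2 : (s' : ℝ) - q' ≠ 0 := sub_ne_zero.2 (by exact_mod_cast hqs'.symm)
  have h3 : beta α q s - beta α q' s' ≠ 0 := by
    rw [← neg_sub]; exact neg_ne_zero.2 hβ
  have ha : ∀ q s : ℤ, a 1 q 1 s = (s : ℝ) - q := by intro q s; unfold a; push_cast; ring
  unfold comb₄
  rw [ha, ha, b_eq_mul_beta, b_eq_mul_beta]
  have e1 : ((s : ℝ) - q) * ((s' - q') * beta α q' s') / (((s : ℝ) - q) * ((s' - q') * beta α q' s')
      - ((s' : ℝ) - q') * ((s - q) * beta α q s)) =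
      beta α q' s' / (beta α q' s' - beta α q s) := by
    rw [div_eq_div_iff _ hβ]
    · ring
    · rw [show ((s : ℝ) - q) * ((s' - q') * beta α q' s') - ((s' : ℝ) - q') * ((s - q) * beta α q s)
        = (s - q) * (s' - q') * (beta α q' s' - beta α q s) by ring]
      positivity
  have e2 : ((s' : ℝ) - q') * ((s - q) * beta α q s) / (((s' : ℝ) - q') * ((s - q) * beta α q s)
      - ((s : ℝ) - q) * ((s' - q') * beta α q' s')) =
      - beta α q s / (beta α q' s' - beta α q s) := by
    rw [div_eq_div_iff _ hβ]
    · ring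
    · rw [show ((s' : ℝ) - q') * ((s - q) * beta α q s) - ((s : ℝ) - q) * ((s' - q') * beta α q' s')
        = (s - q) * (s' - q') * (beta α q s - beta α q' s') by ring]
      positivity
  rw [e1, e2]
  ring

theorem comb₃_swap (α : ℝ) (h : ℤ → ℝ) (p q r s : ℤ) :
    comb₃ α h r s p q = comb₃ α h p q r s := by
  unfold comb₃; rw [add_comm]

theorem comb₄_swap_right (α : ℝ) (h : ℤ → ℝ) (p q r s p' q' r' s' : ℤ) :
    comb₄ α h p q r s r' s' p' q' = comb₄ α h p q r s p' q' r' s' := by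
  have ha : a r' s' p' q' = - a p' q' r' s' := by unfold a; ring
  have hb : b α r' s' p' q' = - b α p' q' r' s' := by unfold b; ring
  have key : ∀ x y : ℝ, -x / (-x - -y) = x / (x - y) := by
    intro x y; rw [← neg_div_neg_eq]; congr 1 <;> ring
  unfold comb₄
  rw [ha, hb, comb₃_swap α h p' q' r' s', mul_neg, neg_mul, key, key]

theorem comb₄_eq_fourPoint_zero {α : ℝ} (h : ℤ → ℝ)
    (hβ : beta α 2 (-2) - beta α 2 0 ≠ 0) :
    comb₄ α h 1 2 1 0 1 2 1 (-2) = fourPoint α h 0 := by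
  rw [comb₄_eq_beta (by norm_num) (by norm_num) hβ, div_eq_iff hβ]
  unfold comb₃ comb₂ fourPoint base divDiff beta
  push_cast
  ring

theorem comb₄_eq_fourPoint_zero' {α : ℝ} (h : ℤ → ℝ)
    (hβ : beta α 2 (-2) - beta α 0 (-2) ≠ 0) :
    comb₄ α h 1 0 1 (-2) 1 2 1 (-2) = fourPoint α h 0 := by
  rw [comb₄_eq_beta (by norm_num) (by norm_num) hβ, div_eq_iff hβ]
  unfold comb₃ comb₂ fourPoint base divDiff beta
  push_cast
  ring

theorem comb₄_eq_fourPoint_neg_one {α : ℝ} (h : ℤ → ℝ)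
    (hβ : beta α 2 (-2) - beta α 2 (-1) ≠ 0) :
    comb₄ α h 1 2 1 (-1) 1 2 1 (-2) = fourPoint α h (-1) := by
  rw [comb₄_eq_beta (by norm_num) (by norm_num) hβ, div_eq_iff hβ]
  unfold comb₃ comb₂ fourPoint base divDiff beta
  push_cast
  ring

theorem comb₄_eq_fourPoint_neg_one' {α : ℝ} (h : ℤ → ℝ)
    (hβ : beta α (-1) (-2) - beta α 2 (-1) ≠ 0) :
    comb₄ α h 1 2 1 (-1) 1 (-1) 1 (-2) = fourPoint α h (-1) := by
  rw [comb₄_eq_beta (by norm_num) (by norm_num) hβ, div_eq_iff hβ]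
  unfold comb₃ comb₂ fourPoint base divDiff beta
  push_cast
  ring

theorem comb₄_eq_fourPoint_neg_one'' {α : ℝ} (h : ℤ → ℝ)
    (hβ : beta α 2 (-2) - beta α (-1) (-2) ≠ 0) :
    comb₄ α h 1 (-1) 1 (-2) 1 2 1 (-2) = fourPoint α h (-1) := by
  rw [comb₄_eq_beta (by norm_num) (by norm_num) hβ, div_eq_iff hβ]
  unfold comb₃ comb₂ fourPoint base divDiff beta
  push_cast
  ring

theorem comb₄_eq_fourPoint_add {α : ℝ} (hα : 1 < α) (h : ℤ → ℝ)
    (hβ : beta α (-1) (-2) - beta α 2 0 ≠ 0) :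
    comb₄ α h 1 2 1 0 1 (-1) 1 (-2) =
      fourPoint α h (-1) - (3 + α) * (12 + α) / (72 * (5 * α - 3)) * fourthDiff h := by
  have e : 5 * α - 3 ≠ 0 := by linarith
  obtain ⟨δ, hδ⟩ : ∃ δ, δ = (3 + α) * (12 + α) / (72 * (5 * α - 3)) := ⟨_, rfl⟩
  have hδ' : δ * (72 * (5 * α - 3)) = (3 + α) * (12 + α) := by
    rw [hδ]; exact div_mul_cancel₀ _ (mul_ne_zero (by norm_num) e)
  rw [comb₄_eq_beta (by norm_num) (by norm_num) hβ, div_eq_iff hβ, ← hδ]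
  unfold comb₃ comb₂ fourPoint base divDiff fourthDiff beta
  push_cast
  linear_combination (-1 / 18) * (h (-2) - 4 * h (-1) + 6 * h 0 - 4 * h 1 + h 2) * hδ'

theorem comb₄_eq_fourPoint_add' {α : ℝ} (hα : α < 2) (h : ℤ → ℝ)
    (hβ : beta α 2 (-2) - beta α 0 (-1) ≠ 0) :
    comb₄ α h 1 0 1 (-1) 1 2 1 (-2) =
      fourPoint α h (-1) +
        (3 - 2 * α) * (24 - 13 * α) / (72 * (6 - α)) * fourthDiff h := by
  have e : 6 - α ≠ 0 := by linarith
  rw [comb₄_eq_beta (by norm_num) (by norm_num) hβ, div_eq_iff hβ]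
  unfold comb₃ comb₂ fourPoint base divDiff fourthDiff beta
  push_cast
  field_simp
  ring

/-- For shifts `1, 2, 1, -2, 1, t, 1, u` the fourth order combination is an affine combination of
the two fourth order combinations at four shifts. -/
theorem comb₄_family {α : ℝ} {h : ℤ → ℝ} {t u : ℤ} (ht : 3 ≤ t) (hu : u ≤ -3)
    (hβ : beta α t u - beta α 2 (-2) ≠ 0) :
    comb₄ α h 1 2 1 (-2) 1 t 1 u =
      (2 * (3 * u + 2 * α) * (t ^ 2 - 4) * fourPoint α h t -
        2 * (3 * t + 2 * α) * (u ^ 2 - 4) * fourPoint α h u) /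
        ((t - u) * (beta α t u - beta α 2 (-2))) := by
  have ht' : (3 : ℝ) ≤ t := by exact_mod_cast ht
  have hu' : (u : ℝ) ≤ -3 := by exact_mod_cast hu
  have n1 : (t : ℝ) - u ≠ 0 := by linarith
  have n1' : (u : ℝ) - t ≠ 0 := by linarith
  have n2 : (t : ℝ) - 1 ≠ 0 := by linarith
  have n2' : 1 - (t : ℝ) ≠ 0 := by linarith
  have n3 : (t : ℝ) - 2 ≠ 0 := by linarith
  have n3' : 2 - (t : ℝ) ≠ 0 := by linarith
  have n4 : (t : ℝ) + 2 ≠ 0 := by linarith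
  have n5 : (u : ℝ) - 1 ≠ 0 := by linarith
  have n5' : 1 - (u : ℝ) ≠ 0 := by linarith
  have n6 : (u : ℝ) - 2 ≠ 0 := by linarith
  have n6' : 2 - (u : ℝ) ≠ 0 := by linarith
  have n7 : (u : ℝ) + 2 ≠ 0 := by linarith
  rw [comb₄_eq_beta (by norm_num) (by omega) hβ, div_eq_div_iff hβ (mul_ne_zero n1 hβ)]
  suffices H : (t - u) * (beta α t u * comb₃ α h 1 2 1 (-2) - beta α 2 (-2) * comb₃ α h 1 t 1 u) =
      (2 * (3 * u + 2 * α) * (t ^ 2 - 4) * fourPoint α h t -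
        2 * (3 * t + 2 * α) * (u ^ 2 - 4) * fourPoint α h u) by
    rw [← H]; ring
  have d1 : (t ^ 2 - 4) * divDiff h t = h 1 * (t ^ 2 - 4) / (3 * (t - 1)) - h 2 * (t + 2) / 4
      - h (-2) * (t - 2) / 12 + h t / (t - 1) := by
    unfold divDiff
    field_simp
    ring
  have d2 : (u ^ 2 - 4) * divDiff h u = h 1 * (u ^ 2 - 4) / (3 * (u - 1)) - h 2 * (u + 2) / 4
      - h (-2) * (u - 2) / 12 + h u / (u - 1) := by
    unfold divDiff
    field_simp
    ring
  have e3 : (t - u) * comb₃ α h 1 t 1 u = -((3 * u + 2 * α) / 3 * ((t * h 1 - h t) / (t - 1))) +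
      (3 * t + 2 * α) / 3 * ((u * h 1 - h u) / (u - 1)) := by
    unfold comb₃ comb₂
    push_cast
    field_simp
    ring
  have e4 : comb₃ α h 1 2 1 (-2) = base α h := by
    unfold comb₃ comb₂ base; push_cast; ring
  calc _ = (t - u) * beta α t u * comb₃ α h 1 2 1 (-2) -
        beta α 2 (-2) * ((t - u) * comb₃ α h 1 t 1 u) := by ring
    _ = 2 * (3 * u + 2 * α) * ((t ^ 2 - 4) * base α h + (24 - 13 * α) / 6 *
          ((t ^ 2 - 4) * divDiff h t)) -
        2 * (3 * t + 2 * α) * ((u ^ 2 - 4) * base α h + (24 - 13 * α) / 6 *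
          ((u ^ 2 - 4) * divDiff h u)) := by
      rw [d1, d2, e3, e4]
      unfold base beta
      push_cast
      field_simp
      ring
    _ = _ := by unfold fourPoint; ring

theorem comb₄_family_two {α : ℝ} {h : ℤ → ℝ} {u : ℤ} (hu : u ≤ -3)
    (hβ : beta α 2 u - beta α 2 (-2) ≠ 0) :
    comb₄ α h 1 2 1 (-2) 1 2 1 u = fourPoint α h u := by
  have hu' : (u : ℝ) ≤ -3 := by exact_mod_cast hu
  have n5 : (u : ℝ) - 1 ≠ 0 := by linarith
  have n5' : 1 - (u : ℝ) ≠ 0 := by linarith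
  have n6 : (u : ℝ) - 2 ≠ 0 := by linarith
  have n6' : 2 - (u : ℝ) ≠ 0 := by linarith
  have n7 : (u : ℝ) + 2 ≠ 0 := by linarith
  rw [comb₄_eq_beta (by norm_num) (by omega) hβ, div_eq_iff hβ]
  unfold comb₃ comb₂ fourPoint base divDiff beta
  push_cast
  field_simp
  ring

theorem comb₄_family_neg_two {α : ℝ} {h : ℤ → ℝ} {t : ℤ} (ht : 3 ≤ t)
    (hβ : beta α t (-2) - beta α 2 (-2) ≠ 0) :
    comb₄ α h 1 2 1 (-2) 1 t 1 (-2) = fourPoint α h t := by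
  have ht' : (3 : ℝ) ≤ t := by exact_mod_cast ht
  have n2 : (t : ℝ) - 1 ≠ 0 := by linarith
  have n2' : 1 - (t : ℝ) ≠ 0 := by linarith
  have n3 : (t : ℝ) - 2 ≠ 0 := by linarith
  have n3' : 2 - (t : ℝ) ≠ 0 := by linarith
  have n4 : (t : ℝ) + 2 ≠ 0 := by linarith
  rw [comb₄_eq_beta (by norm_num) (by omega) hβ, div_eq_iff hβ]
  unfold comb₃ comb₂ fourPoint base divDiff beta
  push_cast
  rw [show 1 * (-2 : ℝ) - 1 * t = -(t + 2) by ring,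
    show 1 * (t : ℝ) - 1 * -2 = t + 2 by ring]
  field_simp
  ring

end WSLD

namespace WSLD

/-! ### Bounds for divided differences -/

theorem monotone_second_diff {r : ℕ → ℝ}
    (h : ∀ j, 0 ≤ r (j + 3) - 3 * r (j + 2) + 3 * r (j + 1) - r j) :
    Monotone fun j => r (j + 2) - 2 * r (j + 1) + r j :=
  monotone_nat_of_le_succ fun j => by
    have := h j
    simp only [show j + 1 + 2 = j + 3 by ring, show j + 1 + 1 = j + 2 by ring]
    linarith

theorem nonneg_of_second_diff_nonneg {r : ℕ → ℝ} {k : ℕ} (h0 : 0 ≤ r k) (h1 : 0 ≤ r (k + 1) - r k)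
    (h : ∀ j, k ≤ j → 0 ≤ r (j + 2) - 2 * r (j + 1) + r j) (n : ℕ) : 0 ≤ r (k + n) := by
  have key : ∀ n, 0 ≤ r (k + n) ∧ 0 ≤ r (k + n + 1) - r (k + n) := by
    intro n
    induction n with
    | zero => exact ⟨h0, h1⟩
    | succ n ih =>
      have := h (k + n) (by omega)
      rw [← add_assoc]
      exact ⟨by linarith, by
        rw [show k + n + 1 + 1 = k + n + 2 by ring]; linarith⟩
  exact (key n).1

theorem nonneg_of_third_diff_nonneg {r : ℕ → ℝ} (h0 : r 0 = 0) (h4 : r 4 = 0)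
    (h13 : r 1 = 0 ∨ r 3 = 0)
    (h : ∀ j, 0 ≤ r (j + 3) - 3 * r (j + 2) + 3 * r (j + 1) - r j) (n : ℕ) :
    0 ≤ r (4 + n) := by
  have e0 := h 0
  have e1 := h 1
  norm_num at e0 e1
  have hmono := monotone_second_diff h
  have h2 : 0 ≤ r 4 - 2 * r 3 + r 2 := by
    rcases h13 with h13 | h13 <;> linarith
  have h3 : 0 ≤ r 4 - r 3 := by
    rcases h13 with h13 | h13 <;> linarith
  have hk : ∀ j, 2 ≤ j → 0 ≤ r (j + 2) - 2 * r (j + 1) + r j := fun j hj => h2.trans (hmono hj)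
  refine nonneg_of_second_diff_nonneg h4.ge ?_ (fun j hj => hk j (by omega)) n
  have := hk 3 (by norm_num)
  norm_num at this ⊢
  linarith

theorem abs_sub_interpolant_le {F : ℕ → ℝ} {B : ℝ}
    (hF : ∀ j, |F (j + 3) - 3 * F (j + 2) + 3 * F (j + 1) - F j| ≤ B) (n : ℕ) :
    |F (4 + n) - (F 0 * (n + 1) * n / 12 - F 3 * (n + 4) * n / 3 + F 4 * (n + 4) * (n + 1) / 4)| ≤
      B * ((n + 4) * (n + 1) * n) / 6 := by
  have key : ∀ s : ℝ, |s| = 1 → 0 ≤ B * ((n + 4) * (n + 1) * n) / 6 + s * (F (4 + n) -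
      (F 0 * (n + 1) * n / 12 - F 3 * (n + 4) * n / 3 + F 4 * (n + 4) * (n + 1) / 4)) := by
    intro s hs
    have := nonneg_of_third_diff_nonneg (r := fun m : ℕ => B * (m * (m - 3) * (m - 4)) / 6 +
      s * (F m - (F 0 * (m - 3) * (m - 4) / 12 - F 3 * m * (m - 4) / 3 + F 4 * m * (m - 3) / 4)))
      (by norm_num; right; ring) (by norm_num) (Or.inr (by norm_num; right; ring)) (fun j => ?_) n
    · convert this using 1
      push_cast
      ring
    · have h1 := hF j
      have h2 : |s * (F (j + 3) - 3 * F (j + 2) + 3 * F (j + 1) - F j)| ≤ B := by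
        rw [abs_mul, hs, one_mul]; exact h1
      have h3 := (abs_le.1 h2).1
      push_cast
      ring_nf at h3 ⊢
      linarith
  have h1 := key 1 (by simp)
  have h2 := key (-1) (by simp)
  exact abs_le.2 ⟨by linarith, by linarith⟩

theorem abs_sub_interpolant_le' {F : ℕ → ℝ} {B : ℝ}
    (hF : ∀ j, |F (j + 3) - 3 * F (j + 2) + 3 * F (j + 1) - F j| ≤ B) (n : ℕ) :
    |F (4 + n) - (F 0 * (n + 3) * n / 4 - F 1 * (n + 4) * n / 3 + F 4 * (n + 4) * (n + 3) / 12)| ≤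
      B * ((n + 4) * (n + 3) * n) / 6 := by
  have key : ∀ s : ℝ, |s| = 1 → 0 ≤ B * ((n + 4) * (n + 3) * n) / 6 + s * (F (4 + n) -
      (F 0 * (n + 3) * n / 4 - F 1 * (n + 4) * n / 3 + F 4 * (n + 4) * (n + 3) / 12)) := by
    intro s hs
    have := nonneg_of_third_diff_nonneg (r := fun m : ℕ => B * (m * (m - 1) * (m - 4)) / 6 +
      s * (F m - (F 0 * (m - 1) * (m - 4) / 4 - F 1 * m * (m - 4) / 3 + F 4 * m * (m - 1) / 12)))
      (by norm_num) (by norm_num; right; ring) (Or.inl (by norm_num; right; ring)) (fun j => ?_) n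
    · convert this using 1
      push_cast
      ring
    · have h1 := hF j
      have h2 : |s * (F (j + 3) - 3 * F (j + 2) + 3 * F (j + 1) - F j)| ≤ B := by
        rw [abs_mul, hs, one_mul]; exact h1
      have h3 := (abs_le.1 h2).1
      push_cast
      ring_nf at h3 ⊢
      linarith
  have h1 := key 1 (by simp)
  have h2 := key (-1) (by simp)
  exact abs_le.2 ⟨by linarith, by linarith⟩

theorem nonneg_of_second_diff_of_zeros {r : ℕ → ℝ} {k : ℕ} (hk : 0 < k) (h0 : r 0 = 0)
    (hrk : r k = 0) (h : ∀ j, 0 ≤ r (j + 2) - 2 * r (j + 1) + r j) (n : ℕ) :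
    0 ≤ r (k + n) := by
  have hmono : Monotone fun j => r (j + 1) - r j := monotone_nat_of_le_succ fun j => by
    have := h j
    simp only [show j + 1 + 1 = j + 2 by ring]
    linarith
  refine nonneg_of_second_diff_nonneg hrk.ge ?_ (fun j _ => h j) n
  by_contra! hlt
  have hneg : ∀ j, j ≤ k → r (j + 1) - r j < 0 := fun j hj => (hmono hj).trans_lt hlt
  have hs : ∑ j ∈ Finset.range k, (r (j + 1) - r j) = 0 := by
    rw [Finset.sum_range_sub, h0, hrk, sub_zero]
  have := Finset.sum_neg (s := Finset.range k) (f := fun j => r (j + 1) - r j)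
    (fun j hj => hneg j (Finset.mem_range.1 hj).le) ⟨0, Finset.mem_range.2 hk⟩
  linarith

theorem abs_sub_chord_le {F : ℕ → ℝ} {B : ℝ} {k : ℕ} (hk : 0 < k)
    (hF : ∀ j, |F (j + 2) - 2 * F (j + 1) + F j| ≤ B) (n : ℕ) :
    |F (k + n) - (F k * (k + n) / k - F 0 * n / k)| ≤ B * ((k + n) * n) / 2 := by
  have hk' : (k : ℝ) ≠ 0 := by positivity
  have key : ∀ s : ℝ, |s| = 1 → 0 ≤ B * ((k + n) * n) / 2 +
      s * (F (k + n) - (F k * (k + n) / k - F 0 * n / k)) := by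
    intro s hs
    have := nonneg_of_second_diff_of_zeros (r := fun m : ℕ => B * (m * (m - k)) / 2 +
      s * (F m - (F k * m / k - F 0 * (m - k) / k))) hk
      (by field_simp; simp) (by field_simp; simp) (fun j => ?_) n
    · convert this using 1
      push_cast
      ring
    · have h1 := hF j
      have h2 : |s * (F (j + 2) - 2 * F (j + 1) + F j)| ≤ B := by
        rw [abs_mul, hs, one_mul]; exact h1
      have h3 := (abs_le.1 h2).1
      push_cast
      ring_nf at h3 ⊢
      linarith
  have h1 := key 1 (by simp)
  have h2 := key (-1) (by simp)
  exact abs_le.2 ⟨by linarith, by linarith⟩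

theorem abs_divDiff_le {h : ℤ → ℝ} {B : ℝ}
    (hB : ∀ j, |h (j + 3) - 3 * h (j + 2) + 3 * h (j + 1) - h j| ≤ B) {t : ℤ} (ht : 3 ≤ |t|) :
    |divDiff h t| ≤ B / 6 := by
  rcases le_abs'.1 ht with ht | ht
  · obtain ⟨n, hn⟩ : ∃ n : ℕ, t = -2 - n := ⟨(-2 - t).toNat, by omega⟩
    have hn1 : 1 ≤ n := by omega
    have hn1' : (1 : ℝ) ≤ n := by exact_mod_cast hn1
    have := abs_sub_interpolant_le' (F := fun j => h (2 - j)) (B := B) (fun j => by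
      have := hB (2 - j - 3)
      rw [← abs_neg] at this
      convert this using 2
      push_cast
      ring_nf) n
    have e : divDiff h t = -(h (2 - (4 + n : ℕ)) - (h (2 - (0 : ℕ)) * (n + 3) * n / 4 -
        h (2 - (1 : ℕ)) * (n + 4) * n / 3 + h (2 - (4 : ℕ)) * (n + 4) * (n + 3) / 12)) /
          ((n + 4) * (n + 3) * n) := by
      have e1 : (2 : ℤ) - (4 + n : ℕ) = -2 - n := by push_cast; ring
      rw [e1]
      subst hn
      unfold divDiff
      norm_num
      have n1 : (1 : ℝ) - (-2 - n) = n + 3 := by ring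
      have n2 : (2 : ℝ) - (-2 - n) = n + 4 := by ring
      have n3 : -2 - (n : ℝ) - 1 = -(n + 3) := by ring
      have n4 : -2 - (n : ℝ) - 2 = -(n + 4) := by ring
      have n5 : -2 - (n : ℝ) + 2 = -n := by ring
      rw [n1, n2, n3, n4, n5]
      have m1 : (n : ℝ) ≠ 0 := by positivity
      have m2 : (n : ℝ) + 3 ≠ 0 := by positivity
      have m3 : (n : ℝ) + 4 ≠ 0 := by positivity
      field_simp
      ring
    rw [e, abs_div, abs_neg, abs_of_pos (a := ((n : ℝ) + 4) * (n + 3) * n) (by positivity),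
      div_le_iff₀ (by positivity)]
    linarith
  · obtain ⟨n, hn⟩ : ∃ n : ℕ, t = 2 + n := ⟨(t - 2).toNat, by omega⟩
    have hn1 : 1 ≤ n := by omega
    have hn1' : (1 : ℝ) ≤ n := by exact_mod_cast hn1
    have := abs_sub_interpolant_le (F := fun j => h (j - 2)) (B := B) (fun j => by
      have := hB (j - 2)
      convert this using 2
      push_cast
      ring_nf) n
    have e : divDiff h t = (h ((4 + n : ℕ) - 2) - (h ((0 : ℕ) - 2) * (n + 1) * n / 12 -
        h ((3 : ℕ) - 2) * (n + 4) * n / 3 + h ((4 : ℕ) - 2) * (n + 4) * (n + 1) / 4)) /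
          ((n + 4) * (n + 1) * n) := by
      have e1 : ((4 + n : ℕ) : ℤ) - 2 = 2 + n := by push_cast; ring
      rw [e1]
      subst hn
      unfold divDiff
      norm_num
      have n1 : (1 : ℝ) - (2 + n) = -(n + 1) := by ring
      have n3 : 2 + (n : ℝ) - 1 = n + 1 := by ring
      have n5 : 2 + (n : ℝ) + 2 = n + 4 := by ring
      rw [n1, n3, n5]
      have m1 : (n : ℝ) ≠ 0 := by positivity
      have m2 : (n : ℝ) + 1 ≠ 0 := by positivity
      have m3 : (n : ℝ) + 4 ≠ 0 := by positivity
      field_simp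
      ring
    rw [e, abs_div, abs_of_pos (a := ((n : ℝ) + 4) * (n + 1) * n) (by positivity),
      div_le_iff₀ (by positivity)]
    linarith

/-- The second divided difference of `h` at the nodes `1, 2, -2`. -/
noncomputable def divDiff₂ (h : ℤ → ℝ) : ℝ := -h 1 / 3 + h 2 / 4 + h (-2) / 12

theorem abs_divDiff_le_of_second {h : ℤ → ℝ} {B : ℝ}
    (hB : ∀ j, |h (j + 2) - 2 * h (j + 1) + h j| ≤ B) {t : ℤ} (ht : 3 ≤ |t|) :
    |divDiff h t| ≤ (B / 2 + |divDiff₂ h|) / 5 := by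
  have hB0 : 0 ≤ B := (abs_nonneg _).trans (hB 0)
  suffices H : ∃ x y : ℝ, |x| ≤ B / 2 ∧ 5 ≤ y ∧ (divDiff h t = (x - divDiff₂ h) / y ∨
      divDiff h t = -(x - divDiff₂ h) / y) by
    obtain ⟨x, y, hx, hy, e⟩ := H
    have hxy : |divDiff h t| = |x - divDiff₂ h| / y := by
      rcases e with e | e
      · rw [e, abs_div, abs_of_pos (a := y) (by linarith)]
      · rw [e, abs_div, abs_neg, abs_of_pos (a := y) (by linarith)]
    rw [hxy]
    have := abs_sub x (divDiff₂ h)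
    exact div_le_div₀ (by positivity) (by linarith) (by norm_num) hy
  rcases le_abs'.1 ht with ht | ht
  · obtain ⟨n, hn⟩ : ∃ n : ℕ, t = -2 - n := ⟨(-2 - t).toNat, by omega⟩
    have hn1 : 1 ≤ n := by omega
    have hn1' : (1 : ℝ) ≤ n := by exact_mod_cast hn1
    have := abs_sub_chord_le (F := fun j => h (1 - j)) (B := B) (k := 3) (by norm_num) (fun j => by
      have := hB (1 - j - 2)
      convert this using 2
      push_cast
      ring_nf) n
    refine ⟨(h (1 - (3 + n : ℕ)) - (h (1 - (3 : ℕ)) * ((3 : ℕ) + n) / (3 : ℕ) -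
      h (1 - (0 : ℕ)) * n / (3 : ℕ))) / ((3 + n) * n), n + 4, ?_, by linarith, Or.inr ?_⟩
    · rw [abs_div, abs_of_pos (a := (3 + (n : ℝ)) * n) (by positivity),
        div_le_iff₀ (by positivity)]
      push_cast at this ⊢
      linarith
    · have e1 : (1 : ℤ) - (3 + n : ℕ) = -2 - n := by push_cast; ring
      rw [e1]
      subst hn
      unfold divDiff divDiff₂
      norm_num
      have n1 : (1 : ℝ) - (-2 - n) = n + 3 := by ring
      have n2 : (2 : ℝ) - (-2 - n) = n + 4 := by ring
      have n3 : -2 - (n : ℝ) - 1 = -(n + 3) := by ring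
      have n4 : -2 - (n : ℝ) - 2 = -(n + 4) := by ring
      have n5 : -2 - (n : ℝ) + 2 = -n := by ring
      rw [n1, n2, n3, n4, n5]
      have m1 : (n : ℝ) ≠ 0 := by positivity
      have m2 : (n : ℝ) + 3 ≠ 0 := by positivity
      have m3 : (n : ℝ) + 4 ≠ 0 := by positivity
      field_simp
      ring
  · obtain ⟨n, hn⟩ : ∃ n : ℕ, t = 2 + n := ⟨(t - 2).toNat, by omega⟩
    have hn1 : 1 ≤ n := by omega
    have hn1' : (1 : ℝ) ≤ n := by exact_mod_cast hn1
    have := abs_sub_chord_le (F := fun j => h (1 + j)) (B := B) (k := 1) (by norm_num) (fun j => by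
      have := hB (1 + j)
      convert this using 2
      push_cast
      ring_nf) n
    refine ⟨(h (1 + (1 + n : ℕ)) - (h (1 + (1 : ℕ)) * ((1 : ℕ) + n) / (1 : ℕ) -
      h (1 + (0 : ℕ)) * n / (1 : ℕ))) / ((1 + n) * n), n + 4, ?_, by linarith, Or.inl ?_⟩
    · rw [abs_div, abs_of_pos (a := (1 + (n : ℝ)) * n) (by positivity),
        div_le_iff₀ (by positivity)]
      push_cast at this ⊢
      linarith
    · have e1 : (1 : ℤ) + (1 + n : ℕ) = 2 + n := by push_cast; ring
      rw [e1]
      subst hn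
      unfold divDiff divDiff₂
      norm_num
      have n1 : (1 : ℝ) - (2 + n) = -(n + 1) := by ring
      have n3 : 2 + (n : ℝ) - 1 = n + 1 := by ring
      have n5 : 2 + (n : ℝ) + 2 = n + 4 := by ring
      rw [n1, n3, n5]
      have m1 : (n : ℝ) ≠ 0 := by positivity
      have m2 : (n : ℝ) + 1 ≠ 0 := by positivity
      have m3 : (n : ℝ) + 4 ≠ 0 := by positivity
      field_simp
      ring

end WSLD

namespace WSLD

/-! ### The generating functions of the first and second power -/

/-- `(1 - z) (3 - z) / 2 = 3/2 - 2 z + z² / 2`. -/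
noncomputable def lubich (z : ℂ) : ℂ := (1 - z) * (3 - z) / 2

/-- The real part of `w z⁻ᵖ` as a function of the shift `p`. -/
noncomputable def shiftRe (w z : ℂ) (p : ℤ) : ℝ := (w * z ^ (-p)).re

theorem mk_mul_mk {d s : ℝ} (hs : s ^ 2 = d * (2 - d)) (A B C D : ℝ) :
    (⟨A, s * B⟩ : ℂ) * ⟨C, s * D⟩ = ⟨A * C - d * (2 - d) * B * D, s * (A * D + B * C)⟩ := by
  apply Complex.ext
  · simp only [Complex.mul_re]; linear_combination (-(B * D)) * hs
  · simp only [Complex.mul_im]; ring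

section circle

variable {d s : ℝ}

theorem lubich_mk (hs : s ^ 2 = d * (2 - d)) :
    lubich ⟨1 - d, s⟩ = ⟨d ^ 2, s * -(1 + d)⟩ := by
  have e1 : (1 : ℂ) - ⟨1 - d, s⟩ = ⟨d, s * -1⟩ := by apply Complex.ext <;> simp
  have e2 : (3 : ℂ) - ⟨1 - d, s⟩ = ⟨2 + d, s * -1⟩ := by
    apply Complex.ext
    · simp; ring
    · simp
  rw [lubich, e1, e2, mk_mul_mk hs, div_eq_iff two_ne_zero]
  apply Complex.ext
  · simp; ring
  · simp; ring

theorem inv_mk (hs : s ^ 2 = d * (2 - d)) : (⟨1 - d, s⟩ : ℂ)⁻¹ = ⟨1 - d, s * -1⟩ := by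
  apply inv_eq_of_mul_eq_one_right
  rw [show (⟨1 - d, s⟩ : ℂ) = ⟨1 - d, s * 1⟩ by rw [mul_one], mk_mul_mk hs]
  apply Complex.ext
  · simp; ring
  · simp

theorem norm_mk (hs : s ^ 2 = d * (2 - d)) : ‖(⟨1 - d, s⟩ : ℂ)‖ = 1 := by
  have : ‖(⟨1 - d, s⟩ : ℂ)‖ ^ 2 = 1 := by
    rw [← Complex.normSq_eq_norm_sq, Complex.normSq_mk]; linarith
  exact (sq_eq_sq₀ (norm_nonneg _) zero_le_one).1 (by rw [this, one_pow])

theorem norm_one_sub_mk_sq (hs : s ^ 2 = d * (2 - d)) :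
    ‖(1 : ℂ) - ⟨1 - d, s⟩‖ ^ 2 = 2 * d := by
  rw [← Complex.normSq_eq_norm_sq, Complex.normSq_apply]
  simp
  linarith

theorem norm_lubich_sq (hs : s ^ 2 = d * (2 - d)) :
    ‖lubich ⟨1 - d, s⟩‖ ^ 2 = d * (2 + 3 * d) := by
  rw [← Complex.normSq_eq_norm_sq, lubich_mk hs, Complex.normSq_mk]
  linear_combination (1 + d) ^ 2 * hs

theorem shiftRe_values (hs : s ^ 2 = d * (2 - d)) (A B : ℝ) :
    shiftRe ⟨A, s * B⟩ ⟨1 - d, s⟩ 0 = A ∧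
    shiftRe ⟨A, s * B⟩ ⟨1 - d, s⟩ 1 = A * (1 - d) + d * (2 - d) * B ∧
    shiftRe ⟨A, s * B⟩ ⟨1 - d, s⟩ (-1) = A * (1 - d) - d * (2 - d) * B ∧
    shiftRe ⟨A, s * B⟩ ⟨1 - d, s⟩ 2 =
      A * (1 - 4 * d + 2 * d ^ 2) + d * (2 - d) * B * (2 * (1 - d)) ∧
    shiftRe ⟨A, s * B⟩ ⟨1 - d, s⟩ (-2) =
      A * (1 - 4 * d + 2 * d ^ 2) - d * (2 - d) * B * (2 * (1 - d)) := by
  have e1 : (⟨1 - d, s⟩ : ℂ) ^ (-(1 : ℤ)) = ⟨1 - d, s * -1⟩ := by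
    rw [zpow_neg_one, inv_mk hs]
  have e1' : (⟨1 - d, s⟩ : ℂ) ^ (-(-1 : ℤ)) = ⟨1 - d, s * 1⟩ := by simp
  have e2 : (⟨1 - d, s⟩ : ℂ) ^ (-(2 : ℤ)) = ⟨1 - d, s * -1⟩ * ⟨1 - d, s * -1⟩ := by
    rw [← inv_mk hs, zpow_neg, ← inv_zpow, zpow_ofNat, sq]
  have e2' : (⟨1 - d, s⟩ : ℂ) ^ (-(-2 : ℤ)) = ⟨1 - d, s * 1⟩ * ⟨1 - d, s * 1⟩ := by
    rw [neg_neg, zpow_ofNat, sq, mul_one]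
  unfold shiftRe
  rw [e1, e1', e2, e2']
  simp only [mk_mul_mk hs]
  refine ⟨by simp, ?_, ?_, ?_, ?_⟩ <;> ring

theorem shiftRe_lubich (hs : s ^ 2 = d * (2 - d)) :
    shiftRe (lubich ⟨1 - d, s⟩) ⟨1 - d, s⟩ 0 = d ^ 2 ∧
    shiftRe (lubich ⟨1 - d, s⟩) ⟨1 - d, s⟩ 1 = -2 * d ∧
    shiftRe (lubich ⟨1 - d, s⟩) ⟨1 - d, s⟩ (-1) = 2 * d + 2 * d ^ 2 - 2 * d ^ 3 ∧
    shiftRe (lubich ⟨1 - d, s⟩) ⟨1 - d, s⟩ 2 = -4 * d + 3 * d ^ 2 ∧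
    shiftRe (lubich ⟨1 - d, s⟩) ⟨1 - d, s⟩ (-2) = 4 * d - d ^ 2 - 8 * d ^ 3 + 4 * d ^ 4 := by
  rw [lubich_mk hs]
  obtain ⟨h0, h1, h2, h3, h4⟩ := shiftRe_values hs (d ^ 2) (-(1 + d))
  rw [h0, h1, h2, h3, h4]
  refine ⟨rfl, ?_, ?_, ?_, ?_⟩ <;> ring

theorem shiftRe_lubich_sq (hs : s ^ 2 = d * (2 - d)) :
    shiftRe (lubich ⟨1 - d, s⟩ ^ 2) ⟨1 - d, s⟩ 0 = -2 * d - 3 * d ^ 2 + 2 * d ^ 4 ∧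
    shiftRe (lubich ⟨1 - d, s⟩ ^ 2) ⟨1 - d, s⟩ 1 = -2 * d - d ^ 2 - d ^ 3 ∧
    shiftRe (lubich ⟨1 - d, s⟩ ^ 2) ⟨1 - d, s⟩ (-1) =
      -2 * d - d ^ 2 + 7 * d ^ 3 + 4 * d ^ 4 - 4 * d ^ 5 ∧
    shiftRe (lubich ⟨1 - d, s⟩ ^ 2) ⟨1 - d, s⟩ 2 = -2 * d + 5 * d ^ 2 ∧
    shiftRe (lubich ⟨1 - d, s⟩ ^ 2) ⟨1 - d, s⟩ (-2) =
      -2 * d + 5 * d ^ 2 + 16 * d ^ 3 - 8 * d ^ 4 - 16 * d ^ 5 + 8 * d ^ 6 := by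
  rw [lubich_mk hs, sq, mk_mul_mk hs]
  obtain ⟨h0, h1, h2, h3, h4⟩ := shiftRe_values hs (d ^ 2 * d ^ 2 - d * (2 - d) * -(1 + d) * -(1 + d))
    (d ^ 2 * -(1 + d) + -(1 + d) * d ^ 2)
  rw [h0, h1, h2, h3, h4]
  refine ⟨?_, ?_, ?_, ?_, ?_⟩ <;> ring

end circle

theorem abs_shiftRe_second_diff_le (w : ℂ) {z : ℂ} (hz : ‖z‖ = 1) (j : ℤ) :
    |shiftRe w z (j + 2) - 2 * shiftRe w z (j + 1) + shiftRe w z j| ≤ ‖w‖ * ‖1 - z‖ ^ 2 := by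
  have hz0 : z ≠ 0 := by rintro rfl; simp at hz
  have e : shiftRe w z (j + 2) - 2 * shiftRe w z (j + 1) + shiftRe w z j =
      (w * z ^ (-(j + 2)) * (1 - z) ^ 2).re := by
    have e1 : z ^ (-j) = z ^ (-(j + 2)) * z ^ 2 := by
      rw [← zpow_natCast, ← zpow_add₀ hz0]; congr 1; push_cast; ring
    have e2 : z ^ (-(j + 1)) = z ^ (-(j + 2)) * z := by
      rw [← zpow_add_one₀ hz0]; congr 1; ring
    have e3 : w * z ^ (-(j + 2)) * (1 - z) ^ 2 =
        w * z ^ (-(j + 2)) - (2 : ℝ) * (w * z ^ (-(j + 1))) + w * z ^ (-j) := by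
      rw [e1, e2]; push_cast; ring
    rw [e3, Complex.add_re, Complex.sub_re, Complex.re_ofReal_mul]
    rfl
  rw [e]
  refine (Complex.abs_re_le_norm _).trans ?_
  rw [norm_mul, norm_mul, norm_zpow, hz, one_zpow, mul_one, norm_pow]

theorem abs_shiftRe_third_diff_le (w : ℂ) {z : ℂ} (hz : ‖z‖ = 1) (j : ℤ) :
    |shiftRe w z (j + 3) - 3 * shiftRe w z (j + 2) + 3 * shiftRe w z (j + 1) - shiftRe w z j| ≤
      ‖w‖ * ‖1 - z‖ ^ 3 := by
  have hz0 : z ≠ 0 := by rintro rfl; simp at hz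
  have e : shiftRe w z (j + 3) - 3 * shiftRe w z (j + 2) + 3 * shiftRe w z (j + 1) - shiftRe w z j =
      (w * z ^ (-(j + 3)) * (1 - z) ^ 3).re := by
    have e0 : z ^ (-j) = z ^ (-(j + 3)) * z ^ 3 := by
      rw [← zpow_natCast, ← zpow_add₀ hz0]; congr 1; push_cast; ring
    have e1 : z ^ (-(j + 1)) = z ^ (-(j + 3)) * z ^ 2 := by
      rw [← zpow_natCast, ← zpow_add₀ hz0]; congr 1; push_cast; ring
    have e2 : z ^ (-(j + 2)) = z ^ (-(j + 3)) * z := by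
      rw [← zpow_add_one₀ hz0]; congr 1; ring
    have e3 : w * z ^ (-(j + 3)) * (1 - z) ^ 3 =
        w * z ^ (-(j + 3)) - (3 : ℝ) * (w * z ^ (-(j + 2))) + (3 : ℝ) * (w * z ^ (-(j + 1)))
          - w * z ^ (-j) := by
      rw [e0, e1, e2]; push_cast; ring
    rw [e3, Complex.sub_re, Complex.add_re, Complex.sub_re, Complex.re_ofReal_mul,
      Complex.re_ofReal_mul]
    rfl
  rw [e]
  refine (Complex.abs_re_le_norm _).trans ?_
  rw [norm_mul, norm_mul, norm_zpow, hz, one_zpow, mul_one, norm_pow]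

/-- The shifts `t` for which the combination at `1, 2, -2, t` is considered. -/
def AdmissibleShift (t : ℤ) : Prop := t = 0 ∨ t = -1 ∨ 3 ≤ |t|

section signs

variable {d s : ℝ}

theorem base_one_lubich (hs : s ^ 2 = d * (2 - d)) :
    base 1 (shiftRe (lubich ⟨1 - d, s⟩) ⟨1 - d, s⟩) =
      -(11 / 9 * d ^ 2 + 16 / 9 * d ^ 3 - 8 / 9 * d ^ 4) := by
  obtain ⟨-, h1, -, h3, h4⟩ := shiftRe_lubich hs
  rw [base, h1, h3, h4]; ring

theorem base_two_lubich (hs : s ^ 2 = d * (2 - d)) :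
    base 2 (shiftRe (lubich ⟨1 - d, s⟩) ⟨1 - d, s⟩) =
      -(7 / 9 * d ^ 2 + 20 / 9 * d ^ 3 - 10 / 9 * d ^ 4) := by
  obtain ⟨-, h1, -, h3, h4⟩ := shiftRe_lubich hs
  rw [base, h1, h3, h4]; ring

theorem base_one_lubich_sq (hs : s ^ 2 = d * (2 - d)) :
    base 1 (shiftRe (lubich ⟨1 - d, s⟩ ^ 2) ⟨1 - d, s⟩) =
      -(2 * d + 5 / 3 * d ^ 2 - 22 / 9 * d ^ 3 + 16 / 9 * d ^ 4 + 32 / 9 * d ^ 5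
        - 16 / 9 * d ^ 6) := by
  obtain ⟨-, h1, -, h3, h4⟩ := shiftRe_lubich_sq hs
  rw [base, h1, h3, h4]; ring

theorem base_two_lubich_sq (hs : s ^ 2 = d * (2 - d)) :
    base 2 (shiftRe (lubich ⟨1 - d, s⟩ ^ 2) ⟨1 - d, s⟩) =
      -(2 * d + 1 / 3 * d ^ 2 - 32 / 9 * d ^ 3 + 20 / 9 * d ^ 4 + 40 / 9 * d ^ 5
        - 20 / 9 * d ^ 6) := by
  obtain ⟨-, h1, -, h3, h4⟩ := shiftRe_lubich_sq hs
  rw [base, h1, h3, h4]; ring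

theorem divDiff₂_lubich (hs : s ^ 2 = d * (2 - d)) :
    divDiff₂ (shiftRe (lubich ⟨1 - d, s⟩) ⟨1 - d, s⟩) =
      2 / 3 * d ^ 2 - 2 / 3 * d ^ 3 + 1 / 3 * d ^ 4 := by
  obtain ⟨-, h1, -, h3, h4⟩ := shiftRe_lubich hs
  rw [divDiff₂, h1, h3, h4]; ring

theorem divDiff₂_lubich_sq (hs : s ^ 2 = d * (2 - d)) :
    divDiff₂ (shiftRe (lubich ⟨1 - d, s⟩ ^ 2) ⟨1 - d, s⟩) =
      2 * d ^ 2 + 5 / 3 * d ^ 3 - 2 / 3 * d ^ 4 - 4 / 3 * d ^ 5 + 2 / 3 * d ^ 6 := by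
  obtain ⟨-, h1, -, h3, h4⟩ := shiftRe_lubich_sq hs
  rw [divDiff₂, h1, h3, h4]; ring

theorem abs_divDiff_lubich_le (hd : 0 < d) (hs : s ^ 2 = d * (2 - d)) {t : ℤ} (ht : 3 ≤ |t|) :
    |divDiff (shiftRe (lubich ⟨1 - d, s⟩) ⟨1 - d, s⟩) t| ≤ 2 / 3 * d ^ 2 * (1 + 3 / 4 * d) := by
  have hz := norm_mk hs
  have := abs_divDiff_le (abs_shiftRe_third_diff_le (lubich ⟨1 - d, s⟩) hz) ht
  refine this.trans ?_
  have hx := norm_nonneg (lubich ⟨1 - d, s⟩)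
  have hy := norm_nonneg ((1 : ℂ) - ⟨1 - d, s⟩)
  have hx2 := norm_lubich_sq hs
  have hy2 := norm_one_sub_mk_sq hs
  set x := ‖lubich ⟨1 - d, s⟩‖
  set y := ‖(1 : ℂ) - ⟨1 - d, s⟩‖
  have hxy : x * y ≤ 2 * d * (1 + 3 / 4 * d) := by
    apply abs_le_of_sq_le_sq' _ (by positivity) |>.2
    rw [mul_pow, hx2, hy2]
    nlinarith [pow_pos hd 4]
  calc x * y ^ 3 / 6 = (x * y) * y ^ 2 / 6 := by ring
    _ ≤ (2 * d * (1 + 3 / 4 * d)) * y ^ 2 / 6 := by gcongr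
    _ = _ := by rw [hy2]; ring

theorem abs_divDiff_lubich_le' (hd : 0 < d) (hs : s ^ 2 = d * (2 - d)) {t : ℤ}
    (ht : 3 ≤ |t|) :
    |divDiff (shiftRe (lubich ⟨1 - d, s⟩) ⟨1 - d, s⟩) t| ≤
      (1 / 2 * d + 29 / 12 * d ^ 2 - 2 / 3 * d ^ 3 + 1 / 3 * d ^ 4) / 5 := by
  have hz := norm_mk hs
  have := abs_divDiff_le_of_second (abs_shiftRe_second_diff_le (lubich ⟨1 - d, s⟩) hz) ht
  refine this.trans ?_
  rw [divDiff₂_lubich hs, norm_one_sub_mk_sq hs, abs_of_nonneg]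
  · have hx2 := norm_lubich_sq hs
    have : ‖lubich ⟨1 - d, s⟩‖ ≤ 1 / 2 + 7 / 4 * d := by
      apply abs_le_of_sq_le_sq' _ (by positivity) |>.2
      rw [hx2]
      nlinarith [sq_nonneg (d - 2)]
    nlinarith
  · nlinarith [mul_nonneg (sq_nonneg d) (sq_nonneg (d - 1)), sq_nonneg d]

theorem abs_divDiff_lubich_sq_le (hd : 0 < d) (hs : s ^ 2 = d * (2 - d)) {t : ℤ}
    (ht : 3 ≤ |t|) :
    |divDiff (shiftRe (lubich ⟨1 - d, s⟩ ^ 2) ⟨1 - d, s⟩) t| ≤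
      (4 * d ^ 2 + 14 / 3 * d ^ 3 - 2 / 3 * d ^ 4 - 4 / 3 * d ^ 5 + 2 / 3 * d ^ 6) / 5 := by
  have hz := norm_mk hs
  have := abs_divDiff_le_of_second (abs_shiftRe_second_diff_le (lubich ⟨1 - d, s⟩ ^ 2) hz) ht
  refine this.trans ?_
  rw [divDiff₂_lubich_sq hs, norm_one_sub_mk_sq hs, norm_pow, norm_lubich_sq hs, abs_of_nonneg]
  · apply le_of_eq; ring
  · rw [show 2 * d ^ 2 + 5 / 3 * d ^ 3 - 2 / 3 * d ^ 4 - 4 / 3 * d ^ 5 + 2 / 3 * d ^ 6 =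
      d ^ 2 * (2 / 3 * (d ^ 2 - d - 1) ^ 2 + 4 / 3 + 1 / 3 * d) by ring]
    positivity

end signs

end WSLD

namespace WSLD

section signs

variable {d s : ℝ}

theorem fourPoint_one_zero (hs : s ^ 2 = d * (2 - d)) :
    fourPoint 1 (shiftRe (lubich ⟨1 - d, s⟩) ⟨1 - d, s⟩) 0 =
      -(7 / 12 * d ^ 3 * (2 - d)) := by
  obtain ⟨h0, h1, -, h3, h4⟩ := shiftRe_lubich hs
  rw [fourPoint, base, divDiff, h0, h1, h3, h4]; push_cast; ring

theorem fourPoint_one_neg_one (hs : s ^ 2 = d * (2 - d)) :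
    fourPoint 1 (shiftRe (lubich ⟨1 - d, s⟩) ⟨1 - d, s⟩) (-1) =
      -(d ^ 3 * (7 / 6 - 5 / 18 * d)) := by
  obtain ⟨-, h1, h2, h3, h4⟩ := shiftRe_lubich hs
  rw [fourPoint, base, divDiff, h1, h2, h3, h4]; push_cast; ring

theorem fourPoint_two_zero (hs : s ^ 2 = d * (2 - d)) :
    fourPoint 2 (shiftRe (lubich ⟨1 - d, s⟩) ⟨1 - d, s⟩) 0 =
      -(d ^ 2 * (1 + 7 / 6 * d * (2 - d))) := by
  obtain ⟨h0, h1, -, h3, h4⟩ := shiftRe_lubich hs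
  rw [fourPoint, base, divDiff, h0, h1, h3, h4]; push_cast; ring

theorem fourPoint_two_neg_one (hs : s ^ 2 = d * (2 - d)) :
    fourPoint 2 (shiftRe (lubich ⟨1 - d, s⟩) ⟨1 - d, s⟩) (-1) =
      -(d ^ 2 * (1 + 7 / 3 * d - 11 / 9 * d ^ 2)) := by
  obtain ⟨-, h1, h2, h3, h4⟩ := shiftRe_lubich hs
  rw [fourPoint, base, divDiff, h1, h2, h3, h4]; push_cast; ring

theorem fourPoint_one_zero_sq (hs : s ^ 2 = d * (2 - d)) :
    fourPoint 1 (shiftRe (lubich ⟨1 - d, s⟩ ^ 2) ⟨1 - d, s⟩) 0 =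
      -(d * (2 + 5 / 3 * d - 11 / 6 * d ^ 2 + 1 / 4 * d ^ 3 + 7 / 3 * d ^ 4 - 7 / 6 * d ^ 5)) := by
  obtain ⟨h0, h1, -, h3, h4⟩ := shiftRe_lubich_sq hs
  rw [fourPoint, base, divDiff, h0, h1, h3, h4]; push_cast; ring

theorem fourPoint_one_neg_one_sq (hs : s ^ 2 = d * (2 - d)) :
    fourPoint 1 (shiftRe (lubich ⟨1 - d, s⟩ ^ 2) ⟨1 - d, s⟩) (-1) =
      -(d * (2 + 5 / 3 * d - 22 / 9 * d ^ 2 - 2 / 3 * d ^ 3 + 7 / 3 * d ^ 4 - 5 / 9 * d ^ 5)) := by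
  obtain ⟨-, h1, h2, h3, h4⟩ := shiftRe_lubich_sq hs
  rw [fourPoint, base, divDiff, h1, h2, h3, h4]; push_cast; ring

theorem fourPoint_two_zero_sq (hs : s ^ 2 = d * (2 - d)) :
    fourPoint 2 (shiftRe (lubich ⟨1 - d, s⟩ ^ 2) ⟨1 - d, s⟩) 0 =
      -(d * (2 + 1 / 3 * d - 11 / 3 * d ^ 2 + 5 / 2 * d ^ 3 + 14 / 3 * d ^ 4 - 7 / 3 * d ^ 5)) := by
  obtain ⟨h0, h1, -, h3, h4⟩ := shiftRe_lubich_sq hs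
  rw [fourPoint, base, divDiff, h0, h1, h3, h4]; push_cast; ring

theorem fourPoint_two_neg_one_sq (hs : s ^ 2 = d * (2 - d)) :
    fourPoint 2 (shiftRe (lubich ⟨1 - d, s⟩ ^ 2) ⟨1 - d, s⟩) (-1) =
      -(d * (2 + 1 / 3 * d - 32 / 9 * d ^ 2 + 8 / 3 * d ^ 3 + 14 / 3 * d ^ 4
        - 22 / 9 * d ^ 5)) := by
  obtain ⟨-, h1, h2, h3, h4⟩ := shiftRe_lubich_sq hs
  rw [fourPoint, base, divDiff, h1, h2, h3, h4]; push_cast; ring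

theorem fourthDiff_lubich (hs : s ^ 2 = d * (2 - d)) :
    fourthDiff (shiftRe (lubich ⟨1 - d, s⟩) ⟨1 - d, s⟩) = 4 * d ^ 4 := by
  obtain ⟨h0, h1, h2, h3, h4⟩ := shiftRe_lubich hs
  rw [fourthDiff, h0, h1, h2, h3, h4]; ring

theorem fourthDiff_lubich_sq (hs : s ^ 2 = d * (2 - d)) :
    fourthDiff (shiftRe (lubich ⟨1 - d, s⟩ ^ 2) ⟨1 - d, s⟩) =
      -(d ^ 3 * (8 + 12 * d - 8 * d ^ 3)) := by
  obtain ⟨h0, h1, h2, h3, h4⟩ := shiftRe_lubich_sq hs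
  rw [fourthDiff, h0, h1, h2, h3, h4]; ring

theorem fourPoint_one_lubich_neg (hd : 0 < d) (hd2 : d < 2) (hs : s ^ 2 = d * (2 - d)) {t : ℤ}
    (ht : AdmissibleShift t) :
    fourPoint 1 (shiftRe (lubich ⟨1 - d, s⟩) ⟨1 - d, s⟩) t < 0 := by
  have h2d : 0 < 2 - d := by linarith
  rcases ht with rfl | rfl | ht
  · rw [fourPoint_one_zero hs, neg_lt_zero]; positivity
  · have : 0 < 7 / 6 - 5 / 18 * d := by linarith
    rw [fourPoint_one_neg_one hs, neg_lt_zero]; positivity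
  · rw [fourPoint, base_one_lubich hs]
    rcases le_total d (1 / 2) with h | h
    · have := (abs_le.1 (abs_divDiff_lubich_le hd hs ht)).2
      have : 0 < d ^ 3 * (31 / 36 - 8 / 9 * d) := mul_pos (by positivity) (by linarith)
      linarith
    · have := (abs_le.1 (abs_divDiff_lubich_le' hd hs ht)).2
      have : 0 < d * (-11 / 60 + 121 / 360 * d + 91 / 90 * d ^ 2 * (2 - d)) :=
        mul_pos hd (by nlinarith [mul_pos hd h2d])
      linarith

theorem fourPoint_two_lubich_neg (hd : 0 < d) (hd2 : d < 2) (hs : s ^ 2 = d * (2 - d)) {t : ℤ}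
    (ht : AdmissibleShift t) :
    fourPoint 2 (shiftRe (lubich ⟨1 - d, s⟩) ⟨1 - d, s⟩) t < 0 := by
  have h2d : 0 < 2 - d := by linarith
  rcases ht with rfl | rfl | ht
  · rw [fourPoint_two_zero hs, neg_lt_zero]; positivity
  · have : 0 < 1 + 7 / 3 * d - 11 / 9 * d ^ 2 := by nlinarith
    rw [fourPoint_two_neg_one hs, neg_lt_zero]; positivity
  · rw [fourPoint, base_two_lubich hs]
    have := (abs_le.1 (abs_divDiff_lubich_le hd hs ht)).1
    have : 0 < d ^ 2 * (5 / 9 + 37 / 18 * d - 10 / 9 * d ^ 2) :=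
      mul_pos (by positivity) (by nlinarith)
    linarith

theorem fourPoint_one_lubich_sq_nonpos (hd : 0 < d) (hd2 : d < 2) (hs : s ^ 2 = d * (2 - d))
    {t : ℤ} (ht : AdmissibleShift t) :
    fourPoint 1 (shiftRe (lubich ⟨1 - d, s⟩ ^ 2) ⟨1 - d, s⟩) t ≤ 0 := by
  have h2d : 0 < 2 - d := by linarith
  rcases ht with rfl | rfl | ht
  · rw [fourPoint_one_zero_sq hs, neg_nonpos]
    refine mul_nonneg hd.le ?_
    nlinarith [mul_pos hd h2d, mul_pos (pow_pos hd 2) h2d, mul_pos (pow_pos hd 3) h2d,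
      mul_pos (pow_pos hd 4) h2d, sq_nonneg (d - 1), mul_nonneg h2d.le (sq_nonneg (d - 1))]
  · rw [fourPoint_one_neg_one_sq hs, neg_nonpos]
    refine mul_nonneg hd.le ?_
    nlinarith [mul_pos hd h2d, mul_pos (pow_pos hd 2) h2d, mul_pos (pow_pos hd 3) h2d,
      mul_pos (pow_pos hd 4) h2d, sq_nonneg (d - 1), mul_nonneg h2d.le (sq_nonneg (d - 1))]
  · rw [fourPoint, base_one_lubich_sq hs]
    have := (abs_le.1 (abs_divDiff_lubich_sq_le hd hs ht)).2
    have : 0 ≤ d * (2 + 1 / 5 * d - 187 / 45 * d ^ 2 + 91 / 45 * d ^ 3 + 91 / 45 * d ^ 4 * (2 - d)) := by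
      refine mul_nonneg hd.le ?_
      nlinarith [mul_pos hd h2d, mul_pos (pow_pos hd 2) h2d, mul_pos (pow_pos hd 3) h2d,
        mul_pos (pow_pos hd 4) h2d, sq_nonneg (d - 1), mul_nonneg h2d.le (sq_nonneg (d - 1))]
    linarith

theorem fourPoint_two_lubich_sq_nonpos (hd : 0 < d) (hd2 : d < 2) (hs : s ^ 2 = d * (2 - d))
    {t : ℤ} (ht : AdmissibleShift t) :
    fourPoint 2 (shiftRe (lubich ⟨1 - d, s⟩ ^ 2) ⟨1 - d, s⟩) t ≤ 0 := by
  have h2d : 0 < 2 - d := by linarith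
  rcases ht with rfl | rfl | ht
  · rw [fourPoint_two_zero_sq hs, neg_nonpos]
    refine mul_nonneg hd.le ?_
    nlinarith [mul_pos hd h2d, mul_pos (pow_pos hd 2) h2d, mul_pos (pow_pos hd 3) h2d,
      mul_pos (pow_pos hd 4) h2d, sq_nonneg (d - 1), mul_nonneg h2d.le (sq_nonneg (d - 1))]
  · rw [fourPoint_two_neg_one_sq hs, neg_nonpos]
    refine mul_nonneg hd.le ?_
    nlinarith [mul_pos hd h2d, mul_pos (pow_pos hd 2) h2d, mul_pos (pow_pos hd 3) h2d,
      mul_pos (pow_pos hd 4) h2d, sq_nonneg (d - 1), mul_nonneg h2d.le (sq_nonneg (d - 1))]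
  · rw [fourPoint, base_two_lubich_sq hs]
    have := (abs_le.1 (abs_divDiff_lubich_sq_le hd hs ht)).1
    have : 0 ≤ d * (2 + 1 / 15 * d - 174 / 45 * d ^ 2 + 102 / 45 * d ^ 3
        + 102 / 45 * d ^ 4 * (2 - d)) := by
      refine mul_nonneg hd.le ?_
      nlinarith [mul_pos hd h2d, mul_pos (pow_pos hd 2) h2d, mul_pos (pow_pos hd 3) h2d,
        mul_pos (pow_pos hd 4) h2d, sq_nonneg (d - 1), mul_nonneg h2d.le (sq_nonneg (d - 1))]
    linarith

end signs

end WSLD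

namespace WSLD

theorem fourPoint_lubich_neg {α d s : ℝ} (h₁ : 1 < α) (h₂ : α < 2) (hd : 0 < d) (hd2 : d < 2)
    (hs : s ^ 2 = d * (2 - d)) {t : ℤ} (ht : AdmissibleShift t) :
    fourPoint α (shiftRe (lubich ⟨1 - d, s⟩) ⟨1 - d, s⟩) t < 0 := by
  rw [fourPoint_eq_mix]
  have := mul_neg_of_pos_of_neg (sub_pos.2 h₂) (fourPoint_one_lubich_neg hd hd2 hs ht)
  have := mul_neg_of_pos_of_neg (sub_pos.2 h₁) (fourPoint_two_lubich_neg hd hd2 hs ht)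
  linarith

theorem fourPoint_lubich_sq_nonpos {α d s : ℝ} (h₁ : 1 < α) (h₂ : α < 2) (hd : 0 < d) (hd2 : d < 2)
    (hs : s ^ 2 = d * (2 - d)) {t : ℤ} (ht : AdmissibleShift t) :
    fourPoint α (shiftRe (lubich ⟨1 - d, s⟩ ^ 2) ⟨1 - d, s⟩) t ≤ 0 := by
  rw [fourPoint_eq_mix]
  have := mul_nonpos_of_nonneg_of_nonpos (sub_pos.2 h₂).le
    (fourPoint_one_lubich_sq_nonpos hd hd2 hs ht)
  have := mul_nonpos_of_nonneg_of_nonpos (sub_pos.2 h₁).le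
    (fourPoint_two_lubich_sq_nonpos hd hd2 hs ht)
  linarith

section family

variable {α : ℝ} {h : ℤ → ℝ} {t u : ℤ}

theorem family_coeff_signs (h₁ : 1 < α) (h₂ : α < 2) (ht : 3 ≤ t) (hu : u ≤ -3) :
    2 * (3 * u + 2 * α) * ((t : ℝ) ^ 2 - 4) < 0 ∧ 0 < 2 * (3 * t + 2 * α) * ((u : ℝ) ^ 2 - 4) ∧
      ((t : ℝ) - u) * (beta α t u - beta α 2 (-2)) < 0 := by
  have ht' : (3 : ℝ) ≤ t := by exact_mod_cast ht
  have hu' : (u : ℝ) ≤ -3 := by exact_mod_cast hu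
  refine ⟨mul_neg_of_neg_of_pos (by linarith) (by nlinarith), mul_pos (by linarith) (by nlinarith),
    mul_neg_of_pos_of_neg (by linarith) ?_⟩
  unfold beta
  push_cast
  nlinarith [mul_nonneg (sub_nonneg.2 ht') (sub_nonneg.2 hu'),
    mul_nonneg (sub_nonneg.2 ht') (sub_pos.2 h₂).le, mul_nonneg (sub_nonneg.2 hu') (sub_pos.2 h₁).le]

theorem comb₄_family_neg (h₁ : 1 < α) (h₂ : α < 2) (ht : 3 ≤ t) (hu : u ≤ -3)
    (hft : fourPoint α h t < 0) (hfu : fourPoint α h u < 0) :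
    comb₄ α h 1 2 1 (-2) 1 t 1 u < 0 := by
  obtain ⟨c1, c2, c3⟩ := family_coeff_signs h₁ h₂ ht hu
  rw [comb₄_family ht hu (right_ne_zero_of_mul c3.ne)]
  refine div_neg_of_pos_of_neg ?_ c3
  have := mul_pos_of_neg_of_neg c1 hft
  have := mul_neg_of_pos_of_neg c2 hfu
  linarith

theorem comb₄_family_nonpos (h₁ : 1 < α) (h₂ : α < 2) (ht : 3 ≤ t) (hu : u ≤ -3)
    (hft : fourPoint α h t ≤ 0) (hfu : fourPoint α h u ≤ 0) :
    comb₄ α h 1 2 1 (-2) 1 t 1 u ≤ 0 := by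
  obtain ⟨c1, c2, c3⟩ := family_coeff_signs h₁ h₂ ht hu
  rw [comb₄_family ht hu (right_ne_zero_of_mul c3.ne)]
  refine div_nonpos_of_nonneg_of_nonpos ?_ c3.le
  have := mul_nonneg_of_nonpos_of_nonpos c1.le hft
  have := mul_nonpos_of_nonneg_of_nonpos c2.le hfu
  linarith

end family

/-- The two sign conditions on a combination `L` of shifts which imply that the real part of
its symbol is negative. -/
def SymbolSigns (α d s : ℝ) (L : (ℤ → ℝ) → ℝ) : Prop :=
  L (shiftRe (lubich ⟨1 - d, s⟩) ⟨1 - d, s⟩) < 0 ∧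
    (2 - α) * d ^ 2 * L (shiftRe (lubich ⟨1 - d, s⟩) ⟨1 - d, s⟩) +
      (α - 1) * L (shiftRe (lubich ⟨1 - d, s⟩ ^ 2) ⟨1 - d, s⟩) ≤ 0

section signs

variable {α d s : ℝ}

theorem SymbolSigns.of_nonpos (h₁ : 1 < α) (h₂ : α < 2) {L : (ℤ → ℝ) → ℝ}
    (hX : L (shiftRe (lubich ⟨1 - d, s⟩) ⟨1 - d, s⟩) < 0)
    (hG : L (shiftRe (lubich ⟨1 - d, s⟩ ^ 2) ⟨1 - d, s⟩) ≤ 0) : SymbolSigns α d s L := by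
  refine ⟨hX, ?_⟩
  have h2 : 0 ≤ (2 - α) * d ^ 2 := mul_nonneg (by linarith) (sq_nonneg d)
  have := mul_nonpos_of_nonneg_of_nonpos h2 hX.le
  have := mul_nonpos_of_nonneg_of_nonpos (sub_pos.2 h₁).le hG
  linarith

theorem symbolSigns_fourPoint (h₁ : 1 < α) (h₂ : α < 2) (hd : 0 < d) (hd2 : d < 2)
    (hs : s ^ 2 = d * (2 - d)) {t : ℤ} (ht : AdmissibleShift t) :
    SymbolSigns α d s (fun h => fourPoint α h t) :=
  .of_nonpos h₁ h₂ (fourPoint_lubich_neg h₁ h₂ hd hd2 hs ht)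
    (fourPoint_lubich_sq_nonpos h₁ h₂ hd hd2 hs ht)

theorem symbolSigns_family_of_le (h₁ : 1 < α) (h₂ : α < 2) (hd : 0 < d) (hd2 : d < 2)
    (hs : s ^ 2 = d * (2 - d)) {t u : ℤ} (ht : 2 ≤ t) (hu : u ≤ -2)
    (hβ : beta α t u - beta α 2 (-2) ≠ 0) :
    SymbolSigns α d s (fun h => comb₄ α h 1 2 1 (-2) 1 t 1 u) := by
  have adm : ∀ x : ℤ, 3 ≤ x ∨ x ≤ -3 → AdmissibleShift x := fun x hx =>
    Or.inr (Or.inr (le_abs'.2 hx.symm))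
  rcases ht.eq_or_lt with rfl | ht
  · rcases hu.eq_or_lt with rfl | hu
    · exact absurd (sub_self _) hβ
    · simp only [comb₄_family_two (show u ≤ -3 by omega) hβ]
      exact symbolSigns_fourPoint h₁ h₂ hd hd2 hs (adm _ (by omega))
  · rcases hu.eq_or_lt with rfl | hu
    · simp only [comb₄_family_neg_two (show 3 ≤ t by omega) hβ]
      exact symbolSigns_fourPoint h₁ h₂ hd hd2 hs (adm _ (by omega))
    · have ht3 : 3 ≤ t := by omega
      have hu3 : u ≤ -3 := by omega
      have at' := adm t (Or.inl ht3)
      have au := adm u (Or.inr hu3)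
      exact .of_nonpos h₁ h₂
        (comb₄_family_neg h₁ h₂ ht3 hu3 (fourPoint_lubich_neg h₁ h₂ hd hd2 hs at')
          (fourPoint_lubich_neg h₁ h₂ hd hd2 hs au))
        (comb₄_family_nonpos h₁ h₂ ht3 hu3 (fourPoint_lubich_sq_nonpos h₁ h₂ hd hd2 hs at')
          (fourPoint_lubich_sq_nonpos h₁ h₂ hd hd2 hs au))

theorem beta_comm (α : ℝ) (q s : ℤ) : beta α q s = beta α s q := by unfold beta; ring

theorem symbolSigns_family (h₁ : 1 < α) (h₂ : α < 2) (hd : 0 < d) (hd2 : d < 2)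
    (hs : s ^ 2 = d * (2 - d)) {t u : ℤ} (ht : 2 ≤ |t|) (hu : 2 ≤ |u|) (htu : t * u < 0)
    (hβ : beta α t u - beta α 2 (-2) ≠ 0) :
    SymbolSigns α d s (fun h => comb₄ α h 1 2 1 (-2) 1 t 1 u) := by
  rcases lt_or_ge 0 t with h | h
  · have hu0 : u < 0 := by by_contra! h'; nlinarith
    rw [abs_of_pos h] at ht
    rw [abs_of_neg hu0] at hu
    exact symbolSigns_family_of_le h₁ h₂ hd hd2 hs ht (by omega) hβ
  · have hu0 : 0 < u := by by_contra! h'; nlinarith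
    rw [abs_of_nonpos h] at ht
    rw [abs_of_pos hu0] at hu
    rw [beta_comm] at hβ
    have := symbolSigns_family_of_le h₁ h₂ hd hd2 hs hu (show t ≤ -2 by omega) hβ
    simpa only [comb₄_swap_right α _ 1 2 1 (-2) 1 t 1 u] using this

theorem fourthDiff_sq_bounds (hd : 0 < d) (hd2 : d < 2) :
    |d ^ 3 * (8 + 12 * d - 8 * d ^ 3)| ≤ 30 *
      (d * (2 + 5 / 3 * d - 22 / 9 * d ^ 2 - 2 / 3 * d ^ 3 + 7 / 3 * d ^ 4 - 5 / 9 * d ^ 5)) ∧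
    |d ^ 3 * (8 + 12 * d - 8 * d ^ 3)| ≤ 30 *
      (d * (2 + 1 / 3 * d - 32 / 9 * d ^ 2 + 8 / 3 * d ^ 3 + 14 / 3 * d ^ 4
        - 22 / 9 * d ^ 5)) := by
  have h2d : 0 < 2 - d := by linarith
  have key : ∀ x y : ℝ, 0 ≤ 30 * y - x → 0 ≤ 30 * y + x → |d * x| ≤ 30 * (d * y) := by
    intro x y hx hy
    rw [abs_mul, abs_of_pos hd]
    have : |x| ≤ 30 * y := abs_le.2 ⟨by linarith, by linarith⟩
    nlinarith
  rw [show d ^ 3 * (8 + 12 * d - 8 * d ^ 3) = d * (8 * d ^ 2 + 12 * d ^ 3 - 8 * d ^ 5) by ring]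
  constructor <;> apply key <;>
  nlinarith [mul_pos hd h2d, mul_pos (pow_pos hd 2) h2d, mul_pos (pow_pos hd 3) h2d,
    mul_pos (pow_pos hd 4) h2d, sq_nonneg (d - 1), mul_nonneg h2d.le (sq_nonneg (d - 1))]

theorem symbolSigns_fourPoint_add_small (h₁ : 1 < α) (h₂ : α < 2) (hd : 0 < d) (hd2 : d < 2)
    (hs : s ^ 2 = d * (2 - d)) {ε : ℝ} (hε : |ε| ≤ 1 / 30) :
    SymbolSigns α d s (fun h => fourPoint α h (-1) + ε * fourthDiff h) := by
  have p1 : 0 < 2 - α := by linarith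
  have p2 : 0 < α - 1 := by linarith
  refine .of_nonpos h₁ h₂ ?_ ?_
  · have e1 : ε * (4 * d ^ 4) ≤ 1 / 30 * (4 * d ^ 4) := by
      have := (abs_le.1 hε).2
      gcongr
    rw [fourPoint_eq_mix, fourPoint_one_neg_one hs, fourPoint_two_neg_one hs, fourthDiff_lubich hs]
    have q1 : 0 < d ^ 3 * (7 / 6 - 5 / 18 * d) - 2 / 15 * d ^ 4 := by
      have : 0 < d ^ 3 * (7 / 6 - 37 / 90 * d) := mul_pos (by positivity) (by linarith)
      linarith
    have q2 : 0 < d ^ 2 * (1 + 7 / 3 * d - 11 / 9 * d ^ 2) - 2 / 15 * d ^ 4 := by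
      have : 0 < d ^ 2 * (1 + 7 / 3 * d - 61 / 45 * d ^ 2) := mul_pos (by positivity) (by nlinarith)
      linarith
    have := mul_pos p1 q1
    have := mul_pos p2 q2
    linarith
  · rw [fourPoint_eq_mix, fourPoint_one_neg_one_sq hs, fourPoint_two_neg_one_sq hs,
      fourthDiff_lubich_sq hs]
    obtain ⟨b1, b2⟩ := fourthDiff_sq_bounds hd hd2
    set m := d ^ 3 * (8 + 12 * d - 8 * d ^ 3)
    have e1 : ε * -m ≤ 1 / 30 * |m| := by
      refine (le_abs_self _).trans ?_
      rw [abs_mul, abs_neg]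
      gcongr
    have := mul_le_mul_of_nonneg_left b1 p1.le
    have := mul_le_mul_of_nonneg_left b2 p2.le
    linarith

theorem symbolSigns_fourPoint_sub (h₁ : 1 < α) (h₂ : α < 2) (hd : 0 < d) (hd2 : d < 2)
    (hs : s ^ 2 = d * (2 - d)) :
    SymbolSigns α d s (fun h => fourPoint α h (-1) -
      (3 + α) * (12 + α) / (72 * (5 * α - 3)) * fourthDiff h) := by
  have p1 : 0 < 2 - α := by linarith
  have p2 : 0 < α - 1 := by linarith
  have p3 : 0 < 72 * (5 * α - 3) := by linarith
  have h2d : 0 < 2 - d := by linarith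
  obtain ⟨e, he⟩ : ∃ e, e = (3 + α) * (12 + α) / (72 * (5 * α - 3)) := ⟨_, rfl⟩
  have he0 : 0 < e := by rw [he]; positivity
  have he' : (3 + α) * (12 + α) = e * (72 * (5 * α - 3)) := by
    rw [he, div_mul_cancel₀ _ p3.ne']
  have hX : fourPoint α (shiftRe (lubich ⟨1 - d, s⟩) ⟨1 - d, s⟩) (-1) - e * (4 * d ^ 4) ≤
      - e * (4 * d ^ 4) := by
    have := fourPoint_lubich_neg h₁ h₂ hd hd2 hs (Or.inr (Or.inl rfl) : AdmissibleShift (-1))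
    linarith
  simp only [← he]
  refine ⟨?_, ?_⟩
  · beta_reduce
    rw [fourthDiff_lubich hs]
    refine hX.trans_lt ?_
    have : 0 < e * (4 * d ^ 4) := by positivity
    linarith
  · beta_reduce
    rw [fourthDiff_lubich hs]
    refine (add_le_add_left (mul_le_mul_of_nonneg_left hX (by positivity)) _).trans ?_
    rw [fourPoint_eq_mix, fourPoint_one_neg_one_sq hs, fourPoint_two_neg_one_sq hs,
      fourthDiff_lubich_sq hs]
    have b1 : 0 ≤ 96 + 80 * d - 256 * d ^ 2 - 240 * d ^ 3 + 112 * d ^ 4 + 820 / 3 * d ^ 5 := by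
      nlinarith [sq_nonneg (d - 4 / 5), mul_nonneg hd.le (sq_nonneg (d - 4 / 5)),
        mul_nonneg (pow_pos hd 2).le (sq_nonneg (d - 4 / 5)),
        mul_nonneg (pow_pos hd 3).le (sq_nonneg (d - 4 / 5))]
    have b2 : 0 ≤ 432 + 296 * d - 904 * d ^ 2 - 468 * d ^ 3 + 616 * d ^ 4 + 616 / 3 * d ^ 5 := by
      nlinarith [sq_nonneg (d - 9 / 10), mul_nonneg hd.le (sq_nonneg (d - 9 / 10)),
        mul_nonneg (pow_pos hd 2).le (sq_nonneg (d - 9 / 10)),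
        mul_nonneg (pow_pos hd 3).le (sq_nonneg (d - 9 / 10))]
    have b3 : 0 ≤ 1008 + 168 * d - 2352 * d ^ 2 + 504 * d ^ 3 + 2352 * d ^ 4 - 672 * d ^ 5 := by
      nlinarith [mul_pos hd h2d, mul_pos (pow_pos hd 2) h2d, mul_pos (pow_pos hd 3) h2d,
        mul_pos (pow_pos hd 4) h2d, sq_nonneg (d - 1), mul_nonneg h2d.le (sq_nonneg (d - 1))]
    have hB : 0 ≤ (2 - α) ^ 3 * (208 * d ^ 5) +
        3 * (α - 1) * (2 - α) ^ 2 *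
          (96 + 80 * d - 256 * d ^ 2 - 240 * d ^ 3 + 112 * d ^ 4 + 820 / 3 * d ^ 5) +
        3 * (α - 1) ^ 2 * (2 - α) *
          (432 + 296 * d - 904 * d ^ 2 - 468 * d ^ 3 + 616 * d ^ 4 + 616 / 3 * d ^ 5) +
        (α - 1) ^ 3 *
          (1008 + 168 * d - 2352 * d ^ 2 + 504 * d ^ 3 + 2352 * d ^ 4 - 672 * d ^ 5) := by
      positivity
    refine nonpos_of_mul_nonpos_left ?_ p3
    have hBd := mul_nonneg hd.le hB
    refine le_of_eq_of_le ?_ (neg_nonpos.2 hBd)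
    linear_combination (-(4 * (2 - α) * d ^ 6) +
      (α - 1) * (d ^ 3 * (8 + 12 * d - 8 * d ^ 3))) * (-he')

/-- The sign conditions hold for all effective shifts. -/
theorem symbolSigns_of_effectiveShifts (h₁ : 1 < α) (h₂ : α < 2) (hd : 0 < d) (hd2 : d < 2)
    (hs : s ^ 2 = d * (2 - d)) {p q r t p' q' r' t' : ℤ}
    (hshifts : EffectiveShifts p q r t p' q' r' t')
    (hw : a p q r t * b α p' q' r' t' ≠ a p' q' r' t' * b α p q r t) :
    SymbolSigns α d s (fun h => comb₄ α h p q r t p' q' r' t') := by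
  have z0 : AdmissibleShift 0 := Or.inl rfl
  have z1 : AdmissibleShift (-1) := Or.inr (Or.inl rfl)
  rcases hshifts with ⟨h, hq, ht, -, hqt⟩ | h | h | h | h | h | h | h <;>
    simp only [Prod.mk.injEq] at h
  · obtain ⟨rfl, rfl, rfl, rfl, rfl, rfl⟩ := h
    exact symbolSigns_family h₁ h₂ hd hd2 hs hq ht hqt (beta_ne_of_weights hw)
  all_goals
    obtain ⟨rfl, rfl, rfl, rfl, rfl, rfl, rfl, rfl⟩ := h
    have hβ := beta_ne_of_weights hw
  · simp only [comb₄_eq_fourPoint_zero _ hβ]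
    exact symbolSigns_fourPoint h₁ h₂ hd hd2 hs z0
  · simp only [comb₄_eq_fourPoint_add h₁ _ hβ]
    exact symbolSigns_fourPoint_sub h₁ h₂ hd hd2 hs
  · simp only [comb₄_eq_fourPoint_neg_one _ hβ]
    exact symbolSigns_fourPoint h₁ h₂ hd hd2 hs z1
  · simp only [comb₄_eq_fourPoint_neg_one' _ hβ]
    exact symbolSigns_fourPoint h₁ h₂ hd hd2 hs z1
  · simp only [comb₄_eq_fourPoint_add' h₂ _ hβ]
    refine symbolSigns_fourPoint_add_small h₁ h₂ hd hd2 hs ?_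
    have h6 : 0 < 72 * (6 - α) := by linarith
    rw [abs_le, le_div_iff₀ h6, div_le_iff₀ h6]
    constructor <;> nlinarith
  · simp only [comb₄_eq_fourPoint_zero' _ hβ]
    exact symbolSigns_fourPoint h₁ h₂ hd hd2 hs z0
  · simp only [comb₄_eq_fourPoint_neg_one'' _ hβ]
    exact symbolSigns_fourPoint h₁ h₂ hd hd2 hs z1

end signs

end WSLD

namespace WSLD

/-! ### Real powers of complex numbers -/

theorem mul_sin_lt_mul_sin {τ ψ : ℝ} (hτ : 0 < τ) (hτ1 : τ < 1) (hψ : 0 < ψ)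
    (hψ2 : ψ < Real.pi / 2) :
    (1 - τ) * Real.cos ψ * Real.sin (τ * ψ) < τ * Real.sin ((1 - τ) * ψ) := by
  have hpi := Real.pi_pos
  have h1τ : 0 < 1 - τ := by linarith
  have hcos : 0 < Real.cos ψ := Real.cos_pos_of_mem_Ioo ⟨by linarith, hψ2⟩
  have h1 : (1 - τ) * Real.sin ψ ≤ Real.sin ((1 - τ) * ψ) := by
    have := strictConcaveOn_sin_Icc.concaveOn.2 (⟨le_rfl, hpi.le⟩ : (0 : ℝ) ∈ Set.Icc 0 Real.pi)
      (⟨hψ.le, by linarith⟩ : ψ ∈ Set.Icc 0 Real.pi) hτ.le h1τ.le (by ring)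
    simpa using this
  have h2 : Real.sin (τ * ψ) < τ * ψ := Real.sin_lt (by positivity)
  have h3 : ψ * Real.cos ψ < Real.sin ψ := by
    have := Real.lt_tan hψ hψ2
    rwa [Real.tan_eq_sin_div_cos, lt_div_iff₀ hcos] at this
  calc (1 - τ) * Real.cos ψ * Real.sin (τ * ψ) < (1 - τ) * Real.cos ψ * (τ * ψ) := by gcongr
    _ = τ * ((1 - τ) * (ψ * Real.cos ψ)) := by ring
    _ ≤ τ * ((1 - τ) * Real.sin ψ) := by gcongr
    _ ≤ _ := by gcongr

/-- A power with exponent between `1` and `2` of a complex number in the right half plane is a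
positive combination of the first and the second power. -/
theorem exists_cpow_eq {α : ℝ} (h₁ : 1 < α) (h₂ : α < 2) {w : ℂ} (hre : 0 < w.re)
    (him : w.im ≠ 0) :
    ∃ A B : ℝ, 0 < A ∧ 0 < B ∧ B * ((2 - α) * w.re) < A * (α - 1) ∧
      w ^ (α : ℂ) = A * w + B * w ^ 2 := by
  have hw : w ≠ 0 := by rintro rfl; simp at hre
  have hρ : 0 < ‖w‖ := norm_pos_iff.2 hw
  set φ := w.arg with hφ
  have hφ2 : |φ| < Real.pi / 2 := Complex.abs_arg_lt_pi_div_two_iff.2 (Or.inl hre)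
  have hφ0 : φ ≠ 0 := fun h => him (Complex.arg_eq_zero_iff.1 h).2
  have hψ : 0 < |φ| := abs_pos.2 hφ0
  have hpi := Real.pi_pos
  have hsψ : 0 < Real.sin |φ| := Real.sin_pos_of_pos_of_lt_pi hψ (by linarith)
  have hs1 : 0 < Real.sin ((2 - α) * |φ|) :=
    Real.sin_pos_of_pos_of_lt_pi (mul_pos (by linarith) hψ) (by nlinarith)
  have hs2 : 0 < Real.sin ((α - 1) * |φ|) :=
    Real.sin_pos_of_pos_of_lt_pi (mul_pos (by linarith) hψ) (by nlinarith)
  have hratio : ∀ x : ℝ, Real.sin (x * |φ|) / Real.sin |φ| = Real.sin (x * φ) / Real.sin φ := by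
    intro x
    rcases abs_cases φ with ⟨h, -⟩ | ⟨h, -⟩
    · rw [h]
    · rw [h, mul_neg, Real.sin_neg, Real.sin_neg, neg_div_neg_eq]
  have hsφ : Real.sin φ ≠ 0 := by
    intro h
    have := hratio (α - 1)
    rw [h, div_zero] at this
    exact (div_pos hs2 hsψ).ne' this
  have hρ1 : ‖w‖ ^ α = ‖w‖ ^ (α - 1) * ‖w‖ := by
    rw [← Real.rpow_add_one hρ.ne']; congr 1; ring
  have hρ2 : ‖w‖ ^ α = ‖w‖ ^ (α - 2) * ‖w‖ ^ 2 := by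
    rw [← Real.rpow_natCast, ← Real.rpow_add hρ]; congr 1; push_cast; ring
  have hρ3 : ‖w‖ ^ (α - 1) = ‖w‖ ^ (α - 2) * ‖w‖ := by
    rw [← Real.rpow_add_one hρ.ne']; congr 1; ring
  have hcos : w.re = ‖w‖ * Real.cos |φ| := by
    rw [Real.cos_abs, hφ, Complex.norm_mul_cos_arg]
  have hexp : w = ‖w‖ * Complex.exp (φ * Complex.I) := (Complex.norm_mul_exp_arg_mul_I w).symm
  refine ⟨‖w‖ ^ (α - 1) * (Real.sin ((2 - α) * |φ|) / Real.sin |φ|),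
    ‖w‖ ^ (α - 2) * (Real.sin ((α - 1) * |φ|) / Real.sin |φ|), by positivity, by positivity, ?_, ?_⟩
  · have := mul_sin_lt_mul_sin (sub_pos.2 h₁) (by linarith) hψ hφ2
    rw [show 1 - (α - 1) = 2 - α by ring] at this
    rw [hcos, hρ3]
    calc _ = ‖w‖ ^ (α - 2) * ‖w‖ / Real.sin |φ| *
          ((2 - α) * Real.cos |φ| * Real.sin ((α - 1) * |φ|)) := by ring
      _ < ‖w‖ ^ (α - 2) * ‖w‖ / Real.sin |φ| * ((α - 1) * Real.sin ((2 - α) * |φ|)) := by gcongr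
      _ = _ := by ring
  · rw [hratio, hratio]
    have hpow : w ^ (α : ℂ) = (‖w‖ ^ α : ℝ) * Complex.exp ((α * φ : ℝ) * Complex.I) := by
      rw [Complex.cpow_def_of_ne_zero hw, Real.rpow_def_of_pos hρ, Complex.ofReal_exp,
        ← Complex.exp_add, Complex.log]
      congr 1
      push_cast
      ring
    have hid : Complex.exp ((α * φ : ℝ) * Complex.I) * (Real.sin φ : ℂ) =
        Real.sin ((2 - α) * φ) * Complex.exp (φ * Complex.I) +
          Real.sin ((α - 1) * φ) * Complex.exp (φ * Complex.I) ^ 2 := by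
      have e2 : Complex.exp (φ * Complex.I) ^ 2 = Complex.exp ((2 * φ : ℝ) * Complex.I) := by
        rw [← Complex.exp_nat_mul]; congr 1; push_cast; ring
      have s1 : Real.sin ((2 - α) * φ) =
          Real.sin (2 * φ) * Real.cos (α * φ) - Real.cos (2 * φ) * Real.sin (α * φ) := by
        rw [← Real.sin_sub]; congr 1; ring
      have s2 : Real.sin ((α - 1) * φ) =
          Real.sin (α * φ) * Real.cos φ - Real.cos (α * φ) * Real.sin φ := by
        rw [← Real.sin_sub]; congr 1; ring
      rw [e2, s1, s2, Real.sin_two_mul, Real.cos_two_mul]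
      apply Complex.ext
      · simp only [Complex.add_re, Complex.re_ofReal_mul, Complex.re_mul_ofReal,
          Complex.exp_ofReal_mul_I_re]
        rw [Real.cos_two_mul]
        ring
      · simp only [Complex.add_im, Complex.im_ofReal_mul, Complex.im_mul_ofReal,
          Complex.exp_ofReal_mul_I_im]
        rw [Real.sin_two_mul]
        ring
    have hsφ' : (Real.sin φ : ℂ) ≠ 0 := by exact_mod_cast hsφ
    have k : ∀ x : ℝ, ((x / Real.sin φ : ℝ) : ℂ) * (Real.sin φ : ℂ) = (x : ℂ) := by
      intro x; rw [← Complex.ofReal_mul, div_mul_cancel₀ _ hsφ]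
    have k1 := k (Real.sin ((2 - α) * φ))
    have k2 := k (Real.sin ((α - 1) * φ))
    have c1 : ((‖w‖ ^ α : ℝ) : ℂ) = (‖w‖ ^ (α - 1) : ℝ) * (‖w‖ : ℂ) := by
      rw [hρ1, Complex.ofReal_mul]
    have c2 : ((‖w‖ ^ α : ℝ) : ℂ) = (‖w‖ ^ (α - 2) : ℝ) * (‖w‖ : ℂ) ^ 2 := by
      rw [hρ2, Complex.ofReal_mul, Complex.ofReal_pow]
    rw [hpow, ← mul_left_inj' hsφ', mul_assoc, hid, Complex.ofReal_mul, Complex.ofReal_mul]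
    generalize ((‖w‖ ^ (α - 1) : ℝ) : ℂ) = r₁ at *
    generalize ((‖w‖ ^ (α - 2) : ℝ) : ℂ) = r₂ at *
    generalize Complex.exp (φ * Complex.I) = E at *
    linear_combination (Real.sin ((2 - α) * φ) * E : ℂ) * c1 +
      (Real.sin ((α - 1) * φ) * E ^ 2 : ℂ) * c2 - r₁ * w * k1 - r₂ * w ^ 2 * k2 -
      r₁ * (Real.sin ((2 - α) * φ) : ℂ) * hexp -
      r₂ * (Real.sin ((α - 1) * φ) : ℂ) * (w + ‖w‖ * E) * hexp

end WSLD

namespace WSLD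

open Filter Topology

/-! ### The generating function of the Lubich coefficients on the unit circle -/

theorem g_succ (α : ℝ) (k : ℕ) : ((k : ℝ) + 1) * g α (k + 1) = (k - α) * g α k := by
  have h := Ring.descPochhammer_eq_factorial_smul_choose α (k + 1)
  have h' := Ring.descPochhammer_eq_factorial_smul_choose α k
  rw [descPochhammer_succ_right, Polynomial.smeval_mul, h', Polynomial.smeval_sub,
    Polynomial.smeval_X, Polynomial.smeval_natCast, Nat.factorial_succ] at h
  simp only [nsmul_eq_mul, pow_one, pow_zero] at h
  push_cast at h
  have hk : (k.factorial : ℝ) ≠ 0 := by exact_mod_cast k.factorial_ne_zero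
  have h2 : Ring.choose α k * (α - k) = (k + 1) * Ring.choose α (k + 1) := by
    apply mul_left_cancel₀ hk
    linear_combination h
  unfold g
  rw [pow_succ]
  linear_combination (-1) ^ k * h2

theorem g_zero (α : ℝ) : g α 0 = 1 := by simp [g]

theorem g_one (α : ℝ) : g α 1 = -α := by simp [g]

theorem g_add_two_nonneg {α : ℝ} (h₁ : 1 < α) (h₂ : α < 2) (k : ℕ) : 0 ≤ g α (k + 2) := by
  induction k with
  | zero =>
    have := g_succ α 1
    rw [g_one] at this
    push_cast at this
    show 0 ≤ g α (1 + 1)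
    nlinarith
  | succ k ih =>
    have := g_succ α (k + 2)
    have h : 0 ≤ ((k + 2 : ℕ) - α) * g α (k + 2) :=
      mul_nonneg (by push_cast; linarith [(Nat.cast_nonneg k : (0 : ℝ) ≤ k)]) ih
    rw [← this] at h
    exact nonneg_of_mul_nonneg_right h (by positivity)

theorem hasSum_g_mul_pow (α : ℝ) {x : ℂ} (hx : ‖x‖ < 1) :
    HasSum (fun k => (g α k : ℂ) * x ^ k) ((1 - x) ^ (α : ℂ)) := by
  have h := (Complex.one_add_cpow_hasFPowerSeriesOnBall_zero (a := (α : ℂ))).hasSum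
    (y := -x) (by simpa [Metric.mem_eball, edist_zero_right, ← ofReal_norm] using hx)
  rw [zero_add, ← sub_eq_add_neg] at h
  refine Eq.subst (motive := fun F => HasSum F _) (funext fun k => ?_) h
  rw [binomialSeries_apply]
  simp only [List.ofFn_const, List.prod_replicate, smul_eq_mul, g]
  rw [Complex.ofReal_mul, Complex.ofReal_choose, neg_pow x k]
  push_cast
  ring

theorem hasSum_g_mul_pow_real (α : ℝ) {r : ℝ} (hr : 0 ≤ r) (hr1 : r < 1) :
    HasSum (fun k => g α k * r ^ k) ((1 - r) ^ α) := by
  have h := hasSum_g_mul_pow α (x := (r : ℂ)) (by simpa [abs_of_nonneg hr] using hr1)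
  rw [show (1 : ℂ) - r = ((1 - r : ℝ) : ℂ) by push_cast; rfl,
    ← Complex.ofReal_cpow (by linarith)] at h
  rw [← Complex.hasSum_ofReal]
  refine Eq.subst (motive := fun F => HasSum F _) (funext fun k => ?_) h
  push_cast
  rfl

theorem summable_abs_g {α : ℝ} (h₁ : 1 < α) (h₂ : α < 2) : Summable fun k => |g α k| := by
  rw [← summable_nat_add_iff 2]
  simp only [abs_of_nonneg (g_add_two_nonneg h₁ h₂ _)]
  refine summable_of_sum_range_le (c := α) (g_add_two_nonneg h₁ h₂) fun n => ?_
  have hlt : ∀ᶠ r : ℝ in 𝓝[<] 1, 0 ≤ r ∧ r < 1 := by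
    filter_upwards [Ioo_mem_nhdsLT (zero_lt_one' ℝ)] with r hr using ⟨hr.1.le, hr.2⟩
  have hcont : Continuous fun r : ℝ => ∑ k ∈ Finset.range n, g α (k + 2) * r ^ (k + 2) := by
    fun_prop
  have ht := (hcont.tendsto 1).mono_left (nhdsWithin_le_nhds (s := Set.Iio 1))
  simp only [one_pow, mul_one] at ht
  refine le_of_tendsto ht ?_
  filter_upwards [hlt] with r hr
  have hs := hasSum_g_mul_pow_real α hr.1 hr.2
  have hs2 := (hasSum_nat_add_iff' 2).2 hs
  have hle := sum_le_hasSum (Finset.range n)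
    (fun k _ => mul_nonneg (g_add_two_nonneg h₁ h₂ k) (pow_nonneg hr.1 _)) hs2
  refine hle.trans ?_
  have h1 : (1 - r) ^ α ≤ 1 := Real.rpow_le_one (by linarith) (by linarith) (by linarith)
  simp only [Finset.sum_range_succ, Finset.sum_range_zero, g_zero, g_one]
  nlinarith

theorem hasSum_g_mul_pow_of_norm_eq_one {α : ℝ} (h₁ : 1 < α) (h₂ : α < 2) {z : ℂ} (hz : ‖z‖ = 1)
    (hz1 : z ≠ 1) : HasSum (fun k => (g α k : ℂ) * z ^ k) ((1 - z) ^ (α : ℂ)) := by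
  have hsum : Summable fun k => (g α k : ℂ) * z ^ k := by
    refine Summable.of_norm ?_
    simpa [hz] using summable_abs_g h₁ h₂
  have hlt : ∀ᶠ r : ℝ in 𝓝[<] 1, 0 ≤ r ∧ r < 1 := by
    filter_upwards [Ioo_mem_nhdsLT (zero_lt_one' ℝ)] with r hr using ⟨hr.1.le, hr.2⟩
  have hid : Tendsto (fun r : ℝ => (r : ℂ)) (𝓝[<] 1) (𝓝 1) := by
    have := (Complex.continuous_ofReal.tendsto 1).mono_left (nhdsWithin_le_nhds (s := Set.Iio 1))
    simpa using this
  have ht1 : Tendsto (fun r : ℝ => ∑' k, (g α k : ℂ) * (r * z) ^ k) (𝓝[<] 1)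
      (𝓝 (∑' k, (g α k : ℂ) * z ^ k)) := by
    refine tendsto_tsum_of_dominated_convergence (summable_abs_g h₁ h₂) (fun k => ?_) ?_
    · have := ((hid.mul_const z).pow k).const_mul (g α k : ℂ)
      simpa using this
    · filter_upwards [hlt] with r hr k
      rw [norm_mul, norm_pow, norm_mul, hz, mul_one, Complex.norm_real, Complex.norm_real,
        Real.norm_eq_abs, Real.norm_eq_abs, abs_of_nonneg hr.1]
      exact mul_le_of_le_one_right (abs_nonneg _) (pow_le_one₀ hr.1 hr.2.le)
  have hre : 0 < (1 - z).re := by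
    have h1 : z.re ≤ 1 := (Complex.re_le_norm z).trans hz.le
    have h2 : z.re ≠ 1 := by
      intro h
      apply hz1
      have h3 : Complex.normSq z = 1 := by rw [Complex.normSq_eq_norm_sq, hz, one_pow]
      rw [Complex.normSq_apply, h] at h3
      have h4 : z.im = 0 := by nlinarith
      exact Complex.ext h h4
    simp only [Complex.sub_re, Complex.one_re]
    exact sub_pos.2 (lt_of_le_of_ne h1 h2)
  have ht2 : Tendsto (fun r : ℝ => (1 - r * z : ℂ) ^ (α : ℂ)) (𝓝[<] 1)
      (𝓝 ((1 - z) ^ (α : ℂ))) := by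
    have h3 : Tendsto (fun r : ℝ => (1 - r * z : ℂ)) (𝓝[<] 1) (𝓝 (1 - z)) := by
      simpa using (hid.mul_const z).const_sub 1
    exact ((continuousAt_cpow_const (Or.inl hre)).tendsto).comp h3
  have heq : (fun r : ℝ => ∑' k, (g α k : ℂ) * (r * z) ^ k) =ᶠ[𝓝[<] 1]
      fun r : ℝ => (1 - r * z : ℂ) ^ (α : ℂ) := by
    filter_upwards [hlt] with r hr
    refine (hasSum_g_mul_pow α ?_).tsum_eq
    simpa [hz, abs_of_nonneg hr.1] using hr.2
  rw [tendsto_nhds_unique (ht1.congr' heq) ht2 |>.symm]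
  exact hsum.hasSum

theorem q_natCast (α : ℝ) (k : ℕ) : q α k = (3 / 2 : ℝ) ^ α *
    ∑ m ∈ Finset.range (k + 1), ((3 : ℝ) ^ m)⁻¹ * g α m * g α (k - m) := by
  rw [q, if_neg (by omega), Int.toNat_natCast]

theorem q_of_neg (α : ℝ) {k : ℤ} (hk : k < 0) : q α k = 0 := by rw [q, if_pos hk]

theorem summable_abs_inv_pow_mul_g {α : ℝ} (h₁ : 1 < α) (h₂ : α < 2) :
    Summable fun m => |((3 : ℝ) ^ m)⁻¹ * g α m| := by
  refine (summable_abs_g h₁ h₂).of_nonneg_of_le (fun m => abs_nonneg _) fun m => ?_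
  rw [abs_mul, abs_of_nonneg (by positivity)]
  exact mul_le_of_le_one_left (abs_nonneg _) (inv_le_one_of_one_le₀ (one_le_pow₀ (by norm_num)))

theorem summable_abs_q {α : ℝ} (h₁ : 1 < α) (h₂ : α < 2) : Summable fun k : ℕ => |q α k| := by
  simp only [q_natCast, abs_mul]
  refine Summable.mul_left _ ?_
  have := summable_norm_sum_mul_range_of_summable_norm (R := ℝ)
    (f := fun m => ((3 : ℝ) ^ m)⁻¹ * g α m) (g := g α)
    (by simpa only [Real.norm_eq_abs] using summable_abs_inv_pow_mul_g h₁ h₂)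
    (by simpa only [Real.norm_eq_abs] using summable_abs_g h₁ h₂)
  simpa only [Real.norm_eq_abs] using this

theorem cpow_lubich {α : ℝ} {z : ℂ} (hz1 : 0 < (1 - z).re) (hz3 : 0 < (1 - z / 3).re) :
    ((3 / 2 : ℝ) ^ α : ℝ) * ((1 - z / 3) ^ (α : ℂ) * (1 - z) ^ (α : ℂ)) = lubich z ^ (α : ℂ) := by
  have n1 : 1 - z ≠ 0 := by intro h; rw [h] at hz1; simp at hz1
  have n3 : 1 - z / 3 ≠ 0 := by intro h; rw [h] at hz3; simp at hz3
  have hl : lubich z = ((3 / 2 : ℝ) : ℂ) * ((1 - z / 3) * (1 - z)) := by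
    unfold lubich; push_cast; ring
  have hn : lubich z ≠ 0 := by
    rw [hl]; exact mul_ne_zero (by norm_num) (mul_ne_zero n3 n1)
  have hlog : Complex.log ((1 - z / 3) * (1 - z)) = Complex.log (1 - z / 3) + Complex.log (1 - z) := by
    rw [Complex.log_mul_eq_add_log_iff n3 n1]
    have a1 := abs_lt.1 (Complex.abs_arg_lt_pi_div_two_iff.2 (Or.inl hz1))
    have a3 := abs_lt.1 (Complex.abs_arg_lt_pi_div_two_iff.2 (Or.inl hz3))
    exact ⟨by linarith, by linarith⟩
  rw [Complex.cpow_def_of_ne_zero n1, Complex.cpow_def_of_ne_zero n3,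
    Complex.cpow_def_of_ne_zero hn, hl, Complex.log_ofReal_mul (by norm_num) (mul_ne_zero n3 n1),
    hlog, Real.rpow_def_of_pos (by norm_num), Complex.ofReal_exp, ← Complex.exp_add,
    ← Complex.exp_add]
  congr 1
  push_cast
  ring

theorem hasSum_q_mul_pow {α : ℝ} (h₁ : 1 < α) (h₂ : α < 2) {z : ℂ} (hz : ‖z‖ = 1)
    (hre : z.re < 1) : HasSum (fun k : ℕ => (q α k : ℂ) * z ^ k) (lubich z ^ (α : ℂ)) := by
  have hz1 : z ≠ 1 := by rintro rfl; simp at hre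
  have hs1 := hasSum_g_mul_pow_of_norm_eq_one h₁ h₂ hz hz1
  have hz3 : ‖z / 3‖ < 1 := by rw [norm_div, hz]; norm_num
  have hs3 := hasSum_g_mul_pow α hz3
  have n1 : Summable fun k => ‖(g α k : ℂ) * z ^ k‖ := by
    simpa [hz] using summable_abs_g h₁ h₂
  have n3 : Summable fun k => ‖(g α k : ℂ) * (z / 3) ^ k‖ := by
    refine (summable_abs_inv_pow_mul_g h₁ h₂).congr fun k => ?_
    rw [norm_mul, norm_pow, norm_div, hz, abs_mul, abs_of_nonneg (by positivity),
      Complex.norm_real, Real.norm_eq_abs]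
    simp [mul_comm]
  have h := hasSum_sum_range_mul_of_summable_norm n3 n1
  rw [hs1.tsum_eq, hs3.tsum_eq] at h
  have h' := h.mul_left (((3 / 2 : ℝ) ^ α : ℝ) : ℂ)
  rw [cpow_lubich (by simpa using hre)
    (by
      rw [show z / 3 = z * ((1 / 3 : ℝ) : ℂ) by push_cast; ring, Complex.sub_re,
        Complex.re_mul_ofReal, Complex.one_re]
      linarith)] at h'
  refine Eq.subst (motive := fun F => HasSum F _) (funext fun k => ?_) h'
  rw [q_natCast]
  push_cast
  rw [mul_assoc, Finset.sum_mul]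
  congr 1
  refine Finset.sum_congr rfl fun m hm => ?_
  have hmk : m ≤ k := Nat.lt_succ_iff.1 (Finset.mem_range.1 hm)
  have hp : z ^ k = z ^ m * z ^ (k - m) := by rw [← pow_add, Nat.add_sub_cancel' hmk]
  rw [hp, div_pow, div_eq_mul_inv]
  ring

end WSLD

namespace WSLD

open Filter Topology MeasureTheory
open scoped ComplexConjugate

/-! ### The quadratic form of a Toeplitz matrix as an integral -/

/-- The point `e^{iθ}` of the unit circle. -/
noncomputable def circlePoint (θ : ℝ) : ℂ := Complex.exp (θ * Complex.I)

theorem circlePoint_ne_zero (θ : ℝ) : circlePoint θ ≠ 0 := Complex.exp_ne_zero _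

theorem norm_circlePoint (θ : ℝ) : ‖circlePoint θ‖ = 1 := Complex.norm_exp_ofReal_mul_I θ

theorem conj_circlePoint (θ : ℝ) : conj (circlePoint θ) = (circlePoint θ)⁻¹ :=
  (Complex.inv_eq_conj (norm_circlePoint θ)).symm

theorem continuous_circlePoint : Continuous circlePoint := by
  unfold circlePoint; fun_prop

theorem continuous_circlePoint_zpow (n : ℤ) : Continuous fun θ => circlePoint θ ^ n :=
  continuous_circlePoint.zpow₀ n fun θ => Or.inl (circlePoint_ne_zero θ)

theorem circlePoint_eq_mk (θ : ℝ) : circlePoint θ = ⟨1 - (1 - Real.cos θ), Real.sin θ⟩ := by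
  rw [circlePoint]
  apply Complex.ext
  · rw [Complex.exp_ofReal_mul_I_re]; ring
  · rw [Complex.exp_ofReal_mul_I_im]

theorem integral_circlePoint_zpow (n : ℤ) :
    ∫ θ in (0 : ℝ)..(2 * Real.pi), circlePoint θ ^ n =
      if n = 0 then ((2 * Real.pi : ℝ) : ℂ) else 0 := by
  split_ifs with h
  · simp [h]
  · have hc : (n : ℂ) * Complex.I ≠ 0 :=
      mul_ne_zero (by exact_mod_cast h) Complex.I_ne_zero
    have e : ∀ θ : ℝ, circlePoint θ ^ n = Complex.exp (n * Complex.I * θ) := by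
      intro θ
      rw [circlePoint, ← Complex.exp_int_mul]
      congr 1
      ring
    simp only [e]
    rw [integral_exp_mul_complex hc, div_eq_zero_iff]
    left
    rw [sub_eq_zero]
    push_cast
    rw [mul_zero, Complex.exp_zero, Complex.exp_eq_one_iff]
    exact ⟨n, by ring⟩

/-- The generating function of the coefficients `q α k` on the unit circle. -/
noncomputable def genFun (α : ℝ) (θ : ℝ) : ℂ := ∑' k : ℕ, (q α k : ℂ) * circlePoint θ ^ k

variable {α : ℝ}

theorem continuous_genFun (h₁ : 1 < α) (h₂ : α < 2) : Continuous (genFun α) := by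
  refine continuous_tsum (fun k => continuous_const.mul (continuous_circlePoint.pow k))
    (summable_abs_q h₁ h₂) fun k θ => ?_
  rw [norm_mul, norm_pow, norm_circlePoint, one_pow, mul_one, Complex.norm_real, Real.norm_eq_abs]

theorem integral_genFun_mul (h₁ : 1 < α) (h₂ : α < 2) (m : ℤ) :
    ∫ θ in (0 : ℝ)..(2 * Real.pi), genFun α θ * circlePoint θ ^ (-m) =
      ((2 * Real.pi : ℝ) : ℂ) * (q α m : ℂ) := by
  have hsum := summable_abs_q h₁ h₂
  have h := intervalIntegral.hasSum_integral_of_dominated_convergence (μ := volume)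
    (a := 0) (b := 2 * Real.pi) (F := fun (k : ℕ) θ => (q α k : ℂ) * circlePoint θ ^ ((k : ℤ) - m))
    (f := fun θ => genFun α θ * circlePoint θ ^ (-m)) (fun k _ => |q α k|)
    (fun k => ((continuous_circlePoint_zpow _).const_mul _).aestronglyMeasurable)
    (fun k => .of_forall fun θ _ => by
      rw [norm_mul, norm_zpow, norm_circlePoint, one_zpow, mul_one, Complex.norm_real,
        Real.norm_eq_abs])
    (.of_forall fun θ _ => hsum) (by simp)
    (.of_forall fun θ _ => by
      have hs : Summable fun k : ℕ => (q α k : ℂ) * circlePoint θ ^ k :=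
        .of_norm (by simpa [norm_circlePoint] using hsum)
      have := hs.hasSum.mul_right (circlePoint θ ^ (-m))
      refine Eq.subst (motive := fun F => HasSum F _) (funext fun k => ?_) this
      rw [mul_assoc, ← zpow_natCast, ← zpow_add₀ (circlePoint_ne_zero θ), sub_eq_add_neg])
  simp only [intervalIntegral.integral_const_mul, integral_circlePoint_zpow] at h
  refine h.unique ?_
  rcases lt_or_ge m 0 with hm | hm
  · rw [q_of_neg α hm]
    have : ∀ k : ℕ, (k : ℤ) - m ≠ 0 := fun k => by omega
    simp [this, hasSum_zero]
  · obtain ⟨l, rfl⟩ := Int.eq_ofNat_of_zero_le hm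
    have := hasSum_single (f := fun k : ℕ => (q α k : ℂ) *
      if (k : ℤ) - (l : ℤ) = 0 then ((2 * Real.pi : ℝ) : ℂ) else 0) l (fun k hk => by
        rw [if_neg (by omega), mul_zero])
    rwa [sub_self, if_pos rfl, mul_comm (q α (l : ℤ) : ℂ)] at this

variable {n : ℕ}

/-- The trigonometric polynomial with coefficients `v`. -/
noncomputable def trigPoly (v : Fin n → ℂ) (θ : ℝ) : ℂ := ∑ j, v j * circlePoint θ ^ (j : ℕ)

theorem continuous_trigPoly (v : Fin n → ℂ) : Continuous (trigPoly v) :=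
  continuous_finsetSum _ fun _ _ => continuous_const.mul (continuous_circlePoint.pow _)

/-- The quadratic form of the Toeplitz matrix shifted by `p`. -/
noncomputable def toeplitzForm (α : ℝ) (v : Fin n → ℂ) (p : ℤ) : ℝ :=
  ∑ i : Fin n, ∑ j : Fin n, (conj (v i) * v j).re * q α (p + (i : ℤ) - (j : ℤ))

theorem continuous_shiftRe_genFun (h₁ : 1 < α) (h₂ : α < 2) (p : ℤ) :
    Continuous fun θ => shiftRe (genFun α θ) (circlePoint θ) p :=
  Complex.continuous_re.comp ((continuous_genFun h₁ h₂).mul (continuous_circlePoint_zpow (-p)))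

theorem integral_shiftRe_genFun (h₁ : 1 < α) (h₂ : α < 2) (v : Fin n → ℂ) (p : ℤ) :
    ∫ θ in (0 : ℝ)..(2 * Real.pi),
      shiftRe (genFun α θ) (circlePoint θ) p * ‖trigPoly v θ‖ ^ 2 =
        2 * Real.pi * toeplitzForm α v p := by
  have hpt : ∀ θ : ℝ, genFun α θ * circlePoint θ ^ (-p) * ((‖trigPoly v θ‖ ^ 2 : ℝ) : ℂ) =
      ∑ i : Fin n, ∑ j : Fin n, conj (v i) * v j *
        (genFun α θ * circlePoint θ ^ (-(p + (i : ℤ) - (j : ℤ)))) := by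
    intro θ
    have hz := circlePoint_ne_zero θ
    have e : ((‖trigPoly v θ‖ ^ 2 : ℝ) : ℂ) = conj (trigPoly v θ) * trigPoly v θ := by
      rw [Complex.conj_mul']; push_cast; rfl
    rw [e, trigPoly, map_sum, Finset.sum_mul_sum, Finset.mul_sum]
    refine Finset.sum_congr rfl fun i _ => ?_
    rw [Finset.mul_sum]
    refine Finset.sum_congr rfl fun j _ => ?_
    rw [map_mul, map_pow, conj_circlePoint,
      show -(p + (i : ℤ) - (j : ℤ)) = -p + -(i : ℤ) + (j : ℤ) by ring, zpow_add₀ hz, zpow_add₀ hz,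
      zpow_neg _ (i : ℤ), zpow_natCast, zpow_natCast, inv_pow]
    ring
  have hcont : ∀ i j : Fin n, Continuous fun θ => conj (v i) * v j *
      (genFun α θ * circlePoint θ ^ (-(p + (i : ℤ) - (j : ℤ)))) := fun i j =>
    continuous_const.mul ((continuous_genFun h₁ h₂).mul (continuous_circlePoint_zpow _))
  have hint : ∫ θ in (0 : ℝ)..(2 * Real.pi),
      genFun α θ * circlePoint θ ^ (-p) * ((‖trigPoly v θ‖ ^ 2 : ℝ) : ℂ) =
      ∑ i : Fin n, ∑ j : Fin n, conj (v i) * v j *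
        (((2 * Real.pi : ℝ) : ℂ) * (q α (p + (i : ℤ) - (j : ℤ)) : ℂ)) := by
    simp only [hpt]
    rw [intervalIntegral.integral_finsetSum fun i _ =>
      (continuous_finsetSum _ fun j _ => hcont i j).intervalIntegrable _ _]
    refine Finset.sum_congr rfl fun i _ => ?_
    rw [intervalIntegral.integral_finsetSum fun j _ => (hcont i j).intervalIntegrable _ _]
    refine Finset.sum_congr rfl fun j _ => ?_
    rw [intervalIntegral.integral_const_mul, integral_genFun_mul h₁ h₂]
  have hc : Continuous fun θ =>
      genFun α θ * circlePoint θ ^ (-p) * ((‖trigPoly v θ‖ ^ 2 : ℝ) : ℂ) :=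
    ((continuous_genFun h₁ h₂).mul (continuous_circlePoint_zpow _)).mul
      (Complex.continuous_ofReal.comp ((continuous_trigPoly v).norm.pow 2))
  have hre := Complex.reCLM.intervalIntegral_comp_comm (hc.intervalIntegrable 0 (2 * Real.pi))
    (μ := volume)
  rw [hint] at hre
  simp only [Complex.reCLM_apply, Complex.re_mul_ofReal] at hre
  unfold shiftRe
  rw [hre, Complex.re_sum, toeplitzForm, Finset.mul_sum]
  refine Finset.sum_congr rfl fun i _ => ?_
  rw [Complex.re_sum, Finset.mul_sum]
  refine Finset.sum_congr rfl fun j _ => ?_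
  rw [← Complex.ofReal_mul, Complex.re_mul_ofReal]
  ring

/-! ### Negativity of the quadratic form -/

theorem exists_comb₄_eq_sum (α : ℝ) (p q r s p' q' r' s' : ℤ) :
    ∃ (c : Fin 8 → ℝ) (k : Fin 8 → ℤ), ∀ h : ℤ → ℝ,
      comb₄ α h p q r s p' q' r' s' = ∑ i, c i * h (k i) := by
  have h₂ : ∀ p q : ℤ, ∃ x y : ℝ, ∀ h : ℤ → ℝ, comb₂ h p q = x * h p + y * h q :=
    fun p q => ⟨_, _, fun h => rfl⟩
  have h₃ : ∀ p q r s : ℤ, ∃ x y z w : ℝ, ∀ h : ℤ → ℝ, comb₃ α h p q r s =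
      x * h p + y * h q + z * h r + w * h s := by
    intro p q r s
    obtain ⟨x, y, h1⟩ := h₂ p q
    obtain ⟨z, w, h2⟩ := h₂ r s
    simp only [comb₃, h1, h2]
    generalize (3 * (r : ℝ) * s + 2 * α) / (3 * ((r : ℝ) * s - p * q)) = W
    generalize (3 * (p : ℝ) * q + 2 * α) / (3 * ((p : ℝ) * q - r * s)) = W'
    exact ⟨W * x, W * y, W' * z, W' * w, fun h => by ring⟩
  obtain ⟨x, y, z, w, h1⟩ := h₃ p q r s
  obtain ⟨x', y', z', w', h2⟩ := h₃ p' q' r' s'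
  simp only [comb₄, h1, h2]
  generalize a p q r s * b α p' q' r' s' / _ = W
  generalize a p' q' r' s' * b α p q r s / _ = W'
  exact ⟨![W * x, W * y, W * z, W * w, W' * x', W' * y', W' * z', W' * w'],
    ![p, q, r, s, p', q', r', s'],
    fun h => by simp [Fin.sum_univ_eight]; ring⟩

theorem exists_trigPoly_ne_zero {v : Fin n → ℂ} (hv : v ≠ 0) :
    ∃ θ ∈ Set.Ioo 0 Real.pi, trigPoly v θ ≠ 0 := by
  by_contra! hzero
  apply hv
  set P : Polynomial ℂ := ∑ j : Fin n, Polynomial.monomial (j : ℕ) (v j)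
  have hP : P = 0 := by
    refine Polynomial.eq_zero_of_infinite_isRoot P ?_
    have hinj : Set.InjOn circlePoint (Set.Ioo 0 Real.pi) := by
      intro x hx y hy hxy
      have := congrArg Complex.re hxy
      rw [circlePoint, circlePoint, Complex.exp_ofReal_mul_I_re, Complex.exp_ofReal_mul_I_re] at this
      exact Real.injOn_cos (Set.Ioo_subset_Icc_self hx) (Set.Ioo_subset_Icc_self hy) this
    refine ((Set.Ioo_infinite Real.pi_pos).image hinj).mono ?_
    rintro _ ⟨θ, hθ, rfl⟩
    have := hzero θ hθ
    simpa [Polynomial.IsRoot, P, Polynomial.eval_finsetSum, trigPoly] using this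
  ext j
  have := congrArg (fun R => Polynomial.coeff R (j : ℕ)) hP
  simpa [P, Polynomial.finsetSum_coeff, Polynomial.coeff_monomial, Fin.val_inj] using this

section

variable {p q r s p' q' r' s' : ℤ}

theorem comb₄_shiftRe_genFun_neg (h₁ : 1 < α) (h₂ : α < 2)
    (hshifts : EffectiveShifts p q r s p' q' r' s')
    (hw : a p q r s * b α p' q' r' s' ≠ a p' q' r' s' * b α p q r s)
    {θ : ℝ} (hθ : Real.sin θ ≠ 0) :
    comb₄ α (shiftRe (genFun α θ) (circlePoint θ)) p q r s p' q' r' s' < 0 := by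
  have hsc := Real.sin_sq_add_cos_sq θ
  have hpos : 0 < Real.sin θ ^ 2 := by positivity
  have hd : 0 < 1 - Real.cos θ := by nlinarith
  have hd2 : 1 - Real.cos θ < 2 := by nlinarith
  have hs : Real.sin θ ^ 2 = (1 - Real.cos θ) * (2 - (1 - Real.cos θ)) := by linarith
  obtain ⟨hX, hG⟩ := symbolSigns_of_effectiveShifts h₁ h₂ hd hd2 hs hshifts hw
  have hl := lubich_mk hs
  rw [← circlePoint_eq_mk] at hX hG hl
  have hgen : genFun α θ = lubich (circlePoint θ) ^ (α : ℂ) :=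
    (hasSum_q_mul_pow h₁ h₂ (norm_circlePoint θ)
      (by rw [circlePoint_eq_mk]; simpa using hd)).tsum_eq
  have hre : (lubich (circlePoint θ)).re = (1 - Real.cos θ) ^ 2 := by rw [hl]
  obtain ⟨A, B, hA, hB, hAB, hpow⟩ := exists_cpow_eq h₁ h₂ (w := lubich (circlePoint θ))
    (by rw [hre]; positivity)
    (by rw [hl]; exact mul_ne_zero hθ (neg_ne_zero.2 (by linarith)))
  have hlin : shiftRe (genFun α θ) (circlePoint θ) = fun k =>
      A * shiftRe (lubich (circlePoint θ)) (circlePoint θ) k +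
        B * shiftRe (lubich (circlePoint θ) ^ 2) (circlePoint θ) k := by
    ext k
    unfold shiftRe
    rw [hgen, hpow, add_mul, mul_assoc, mul_assoc, Complex.add_re, Complex.re_ofReal_mul,
      Complex.re_ofReal_mul]
  have hcomb : comb₄ α (shiftRe (genFun α θ) (circlePoint θ)) p q r s p' q' r' s' =
      A * comb₄ α (shiftRe (lubich (circlePoint θ)) (circlePoint θ)) p q r s p' q' r' s' +
      B * comb₄ α (shiftRe (lubich (circlePoint θ) ^ 2) (circlePoint θ)) p q r s p' q' r' s' := by
    obtain ⟨c, k, hck⟩ := exists_comb₄_eq_sum α p q r s p' q' r' s'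
    rw [hck, hck, hck, hlin, Finset.mul_sum, Finset.mul_sum, ← Finset.sum_add_distrib]
    exact Finset.sum_congr rfl fun i _ => by ring
  rw [hcomb]
  rw [hre] at hAB
  beta_reduce at hX hG
  set X := comb₄ α (shiftRe (lubich (circlePoint θ)) (circlePoint θ)) p q r s p' q' r' s'
  set G := comb₄ α (shiftRe (lubich (circlePoint θ) ^ 2) (circlePoint θ)) p q r s p' q' r' s'
  have h3 : (α - 1) * (A * X + B * G) < 0 := by
    have := mul_le_mul_of_nonneg_left hG hB.le
    have := mul_neg_of_pos_of_neg (sub_pos.2 hAB) hX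
    linarith
  exact neg_of_mul_neg_right h3 (by linarith)

theorem comb₄_toeplitzForm_neg (h₁ : 1 < α) (h₂ : α < 2)
    (hshifts : EffectiveShifts p q r s p' q' r' s')
    (hw : a p q r s * b α p' q' r' s' ≠ a p' q' r' s' * b α p q r s)
    {v : Fin n → ℂ} (hv : v ≠ 0) :
    comb₄ α (toeplitzForm α v) p q r s p' q' r' s' < 0 := by
  have hpi := Real.pi_pos
  obtain ⟨c, k, hck⟩ := exists_comb₄_eq_sum α p q r s p' q' r' s'
  set F : ℝ → ℝ := fun θ =>
    -(comb₄ α (shiftRe (genFun α θ) (circlePoint θ)) p q r s p' q' r' s' * ‖trigPoly v θ‖ ^ 2)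
    with hF
  have hcont : Continuous F := by
    simp only [hF, hck]
    exact ((continuous_finsetSum _ fun i _ =>
      (continuous_shiftRe_genFun h₁ h₂ (k i)).const_mul _).mul
        ((continuous_trigPoly v).norm.pow 2)).neg
  have hint : ∫ θ in (0 : ℝ)..(2 * Real.pi), F θ =
      -(2 * Real.pi * comb₄ α (toeplitzForm α v) p q r s p' q' r' s') := by
    simp only [hF, hck, intervalIntegral.integral_neg, Finset.sum_mul, mul_assoc]
    have hci : ∀ i : Fin 8, Continuous fun θ =>
        c i * (shiftRe (genFun α θ) (circlePoint θ) (k i) * ‖trigPoly v θ‖ ^ 2) := fun i =>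
      ((continuous_shiftRe_genFun h₁ h₂ (k i)).mul ((continuous_trigPoly v).norm.pow 2)).const_mul _
    rw [intervalIntegral.integral_finsetSum fun i _ => (hci i).intervalIntegrable _ _]
    simp only [intervalIntegral.integral_const_mul, integral_shiftRe_genFun h₁ h₂, Finset.mul_sum]
    exact congrArg _ (Finset.sum_congr rfl fun i _ => by ring)
  have hdense : Dense {θ : ℝ | Real.sin θ ≠ 0} := by
    have : {θ : ℝ | Real.sin θ = 0}.Countable := by
      refine (Set.countable_range fun m : ℤ => (m : ℝ) * Real.pi).mono ?_
      intro θ hθ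
      obtain ⟨m, hm⟩ := Real.sin_eq_zero_iff.1 hθ
      exact ⟨m, hm⟩
    exact this.dense_compl ℝ
  have hnonneg : ∀ θ, 0 ≤ F θ := by
    have hclosed : IsClosed {θ | 0 ≤ F θ} := isClosed_le continuous_const hcont
    have hsub : {θ : ℝ | Real.sin θ ≠ 0} ⊆ {θ | 0 ≤ F θ} := by
      intro θ hθ
      have := comb₄_shiftRe_genFun_neg h₁ h₂ hshifts hw hθ
      simp only [Set.mem_ofPred_eq, hF, neg_nonneg]
      exact mul_nonpos_of_nonpos_of_nonneg this.le (sq_nonneg _)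
    intro θ
    exact hclosed.closure_subset_iff.2 hsub (hdense θ)
  obtain ⟨θ, hθ, hVθ⟩ := exists_trigPoly_ne_zero hv
  have hpos : 0 < F θ := by
    have := comb₄_shiftRe_genFun_neg h₁ h₂ hshifts hw (Real.sin_pos_of_mem_Ioo hθ).ne'
    simp only [hF, neg_pos]
    exact mul_neg_of_neg_of_pos this (by positivity)
  have := intervalIntegral.integral_pos (by positivity : (0 : ℝ) < 2 * Real.pi)
    hcont.continuousOn (fun θ _ => hnonneg θ) ⟨θ, ⟨hθ.1.le, by linarith [hθ.2]⟩, hpos⟩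
  rw [hint] at this
  nlinarith

end

end WSLD

namespace WSLD

open scoped ComplexConjugate

/-! ### Eigenvalues -/

variable {n : ℕ}

theorem A₄_apply (α : ℝ) (p q r s p' q' r' s' : ℤ) (i j : Fin n) :
    A₄ α n p q r s p' q' r' s' i j =
      comb₄ α (fun k => WSLD.q α (k + (i : ℤ) - (j : ℤ))) p q r s p' q' r' s' := by
  simp only [A₄, A₃, A₂, A₁, comb₄, comb₃, comb₂, Matrix.add_apply, Matrix.smul_apply,
    Matrix.of_apply, smul_eq_mul]

theorem sum_A₄_eq_comb₄ (α : ℝ) (p q r s p' q' r' s' : ℤ) (v : Fin n → ℂ) :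
    ∑ i, ∑ j, (conj (v i) * v j).re * A₄ α n p q r s p' q' r' s' i j =
      comb₄ α (toeplitzForm α v) p q r s p' q' r' s' := by
  obtain ⟨c, k, hck⟩ := exists_comb₄_eq_sum α p q r s p' q' r' s'
  simp only [A₄_apply, hck, toeplitzForm, Finset.mul_sum]
  conv_rhs => rw [Finset.sum_comm]
  refine Finset.sum_congr rfl fun i _ => ?_
  conv_rhs => rw [Finset.sum_comm]
  refine Finset.sum_congr rfl fun j _ => Finset.sum_congr rfl fun l _ => by ring

theorem sum_re_mul_mulVec (N : Matrix (Fin n) (Fin n) ℝ) (v : Fin n → ℂ) :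
    (∑ i, conj (v i) * (N.map (fun x : ℝ => (x : ℂ))).mulVec v i).re =
      ∑ i, ∑ j, (conj (v i) * v j).re * N i j := by
  rw [Complex.re_sum]
  refine Finset.sum_congr rfl fun i _ => ?_
  rw [Matrix.mulVec, dotProduct, Finset.mul_sum, Complex.re_sum]
  refine Finset.sum_congr rfl fun j _ => ?_
  rw [Matrix.map_apply, ← Complex.re_mul_ofReal]
  congr 1
  ring

theorem sum_mul_add_smul_transpose (N : Matrix (Fin n) (Fin n) ℝ) (κ : ℝ) (v : Fin n → ℂ) :
    ∑ i, ∑ j, (conj (v i) * v j).re * (N + κ • N.transpose) i j =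
      (1 + κ) * ∑ i, ∑ j, (conj (v i) * v j).re * N i j := by
  have hsymm : ∑ i, ∑ j, (conj (v i) * v j).re * N j i =
      ∑ i, ∑ j, (conj (v i) * v j).re * N i j := by
    rw [Finset.sum_comm]
    refine Finset.sum_congr rfl fun i _ => Finset.sum_congr rfl fun j _ => ?_
    congr 1
    simp only [Complex.mul_re, Complex.conj_re, Complex.conj_im]
    ring
  calc _ = ∑ i, ∑ j, ((conj (v i) * v j).re * N i j + κ * ((conj (v i) * v j).re * N j i)) := by
        refine Finset.sum_congr rfl fun i _ => Finset.sum_congr rfl fun j _ => ?_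
        simp only [Matrix.add_apply, Matrix.smul_apply, Matrix.transpose_apply, smul_eq_mul]
        ring
    _ = _ := by
        simp only [Finset.sum_add_distrib, ← Finset.mul_sum]
        rw [hsymm]
        ring

/-- If the real quadratic form of `N` is negative definite and `d ≥ 0`, the eigenvalues of
`diag d * N` other than zero lie in the left half plane. -/
theorem re_neg_of_isEigenvalue {N : Matrix (Fin n) (Fin n) ℝ}
    (hN : ∀ v : Fin n → ℂ, v ≠ 0 → ∑ i, ∑ j, (conj (v i) * v j).re * N i j < 0)
    {d : Fin n → ℝ} (hd : ∀ i, 0 ≤ d i) {z : ℂ}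
    (hz : IsEigenvalue (Matrix.diagonal d * N) z) (hd' : z ≠ 0 ∨ ∀ i, 0 < d i) : z.re < 0 := by
  obtain ⟨v, hv⟩ := hz.exists_hasEigenvector
  have hv0 : v ≠ 0 := hv.2
  set y := (N.map (fun x : ℝ => (x : ℂ))).mulVec v with hy
  have heq : ∀ i, (d i : ℂ) * y i = z * v i := by
    intro i
    have h := congrFun hv.apply_eq_smul i
    rw [Matrix.toLin'_apply] at h
    rw [← smul_eq_mul z, ← Pi.smul_apply, ← h, hy, Matrix.mulVec, Matrix.mulVec, dotProduct,
      dotProduct, Finset.mul_sum]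
    refine Finset.sum_congr rfl fun j _ => ?_
    simp only [Matrix.map_apply, Matrix.diagonal_mul]
    push_cast
    ring
  have hT : (∑ i, conj (v i) * y i).re < 0 := by
    rw [hy, sum_re_mul_mulVec]
    exact hN v hv0
  have hz0 : z ≠ 0 := by
    rcases hd' with h | h
    · exact h
    · rintro rfl
      have : ∀ i, y i = 0 := fun i => by
        have hi := heq i
        rw [zero_mul, mul_eq_zero] at hi
        exact hi.resolve_left (by exact_mod_cast (h i).ne')
      simp [this] at hT
  have hR : conj z * ∑ i, conj (v i) * y i = ((∑ i, d i * ‖y i‖ ^ 2 : ℝ) : ℂ) := by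
    rw [Finset.mul_sum, Complex.ofReal_sum]
    refine Finset.sum_congr rfl fun i _ => ?_
    have h := congrArg conj (heq i)
    rw [map_mul, map_mul, Complex.conj_ofReal] at h
    rw [← mul_assoc, ← h, mul_assoc, Complex.conj_mul']
    push_cast
    rfl
  have h1 : ((‖z‖ ^ 2 : ℝ) : ℂ) * ∑ i, conj (v i) * y i =
      z * ((∑ i, d i * ‖y i‖ ^ 2 : ℝ) : ℂ) := by
    rw [← hR, ← mul_assoc, Complex.mul_conj']
    push_cast
    rfl
  have h2 := congrArg Complex.re h1
  rw [Complex.re_ofReal_mul, Complex.re_mul_ofReal] at h2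
  have hnn : 0 ≤ ∑ i, d i * ‖y i‖ ^ 2 :=
    Finset.sum_nonneg fun i _ => mul_nonneg (hd i) (sq_nonneg _)
  have hzn : 0 < ‖z‖ ^ 2 := by positivity
  have := mul_neg_of_pos_of_neg hzn hT
  rw [h2] at this
  exact neg_of_mul_neg_left this hnn

end WSLD

theorem theorem4p1 (α : ℝ) (hα₁ : 1 < α) (hα₂ : α < 2) (n : ℕ)
    (p q r s p' q' r' s' : ℤ)
    (hshifts : WSLD.EffectiveShifts p q r s p' q' r' s')
    (hweights : WSLD.a p q r s * WSLD.b α p' q' r' s' ≠ WSLD.a p' q' r' s' * WSLD.b α p q r s)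
    (d : Fin n → ℝ) (hd : ∀ i, 0 ≤ d i) (κ : ℝ) (hκ : 0 ≤ κ) :
    (∀ z : ℂ,
      WSLD.IsEigenvalue (Matrix.diagonal d *
        (WSLD.A₄ α n p q r s p' q' r' s' +
          κ • (WSLD.A₄ α n p q r s p' q' r' s').transpose)) z →
      z ≠ 0 → z.re < 0) ∧
    ((∀ i, 0 < d i) → ∀ z : ℂ,
      WSLD.IsEigenvalue (Matrix.diagonal d *
        (WSLD.A₄ α n p q r s p' q' r' s' +
          κ • (WSLD.A₄ α n p q r s p' q' r' s').transpose)) z →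
      z.re < 0) := by
  have hN : ∀ v : Fin n → ℂ, v ≠ 0 → ∑ i, ∑ j, ((starRingEnd ℂ) (v i) * v j).re *
      (WSLD.A₄ α n p q r s p' q' r' s' +
        κ • (WSLD.A₄ α n p q r s p' q' r' s').transpose) i j < 0 := by
    intro v hv
    rw [WSLD.sum_mul_add_smul_transpose, WSLD.sum_A₄_eq_comb₄]
    exact mul_neg_of_pos_of_neg (by linarith)
      (WSLD.comb₄_toeplitzForm_neg hα₁ hα₂ hshifts hweights hv)
  exact ⟨fun z hz hz0 => WSLD.re_neg_of_isEigenvalue hN hd hz (Or.inl hz0),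
    fun hd' z hz => WSLD.re_neg_of_isEigenvalue hN hd hz (Or.inr hd')⟩
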